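/- Let $k$ be a field and let $(\mathcal C,\otimes,I,C)$ be a braided monoidal category with equalizers, equipped with a faithful strong monoidal ("forgetful") functor $F:\mathcal C\to{}_k\mathcal M$ to $k$-vector spaces, so $F(U\otimes V)\cong F(U)\otimes F(V)$, $F(I)\cong k$; $F$ need not respect the braidings. Elements of an object $U$ are elements of $F(U)$. (Associativity and unit constraints are suppressed, and the identity of $U$ is written $U$.) Let $H$ be a Hopf algebra in $\mathcal C$ with structure $m,\eta,\Delta,\epsilon,S$ and $C_{H,H}=C_{H,H}^{-1}$. Let $H^d$ be a faithful quasi-dual of $H$ with $H^d\subseteq H^*$. That is, $H^d$ is an algebra in $\mathcal C$ with a morphism $\langle\,,\rangle:H^d\otimes H\to I$ such that $$\langle\,,\rangle(m\otimes H)=(\langle\,,\rangle\otimes\langle\,,\rangle)(H^d\otimes C_{H^d,H}\otimes H)(H^d\otimes H^d\otimes\Delta),\qquad \langle\,,\rangle(\eta\otimes H)=\epsilon;$$ for all objects $U,V$, a morphism $f:U\to V\otimes H^d$ is determined by $(V\otimes\langle\,,\rangle)(f\otimes H)$ and a morphism $g:U\to H\otimes V$ is determined by $(\langle\,,\rangle\otimes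 V)(H^d\otimes g)$; and the induced linear map $F(H^d)\to F(H)^*=\mathrm{Hom}_k(F(H),k)$ is injective. A left $H^d$-module $(M,\alpha)$ in $\mathcal C$ is rational if there is a morphism $\rho:M\to M\otimes H$ with $(M\otimes\langle\,,\rangle)(C_{H^d,M}\otimes H)(H^d\otimes\rho)=\alpha$. Assume that the regular left module $H^d$ has a maximal rational submodule $i:H^{d\,rat}\to H^d$ in $\mathcal C$ (submodules are given by monomorphisms of $\mathcal C$ that are module maps; maximal means that $H^{d\,rat}$ is rational and every rational submodule factors through $i$), with $\rho:H^{d\,rat}\to H^{d\,rat}\otimes H$ as above. Assume that there is a morphism $\rightharpoonup:H\otimes H^d\to H^d$ in $\mathcal C$ with $$\langle\,,\rangle(\rightharpoonup\otimes H)=\langle\,,\rangle(H^d\otimes m)(H^d\otimes C_{H,H})(C_{H,H^d}\otimes H),$$ and that it restricts to a morphism $H\otimes H^{d\,rat}\to H^{d\,rat}$ in $\mathcal C$. Then $H^{d\,rat}$, with the action $\leftharpoondown\;=\;\rightharpoonup(S\otimes H^{d\,rat})C_{H^{d\,rat},H}$ and the coaction $\rho$, is a right $H$-Hopf module in $\mathcal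 C$, the object of left integrals $\int^l_{H^d}$ exists in $\mathcal C$, and $$H^{d\,rat}\cong\int^l_{H^d}\otimes H\qquad\text{as right $H$-Hopf modules in }\mathcal C,$$ where $\int^l_{H^d}\otimes H$ carries the action $\int^l_{H^d}\otimes m$ and the coaction $\int^l_{H^d}\otimes\Delta$. Here $\int^l_{H^d}$ is the set $\{f\in H^d\mid g*f=g(1)f\text{ for every }g\in H^d\}$ regarded in $\mathcal C$, i.e. the greatest subobject of $H^d$ in $\mathcal C$ all of whose elements lie in this set ($*$ is the product of $H^d$ and $g(1)=\langle g,1_H\rangle$). If this set is the image of $F(t)$ for some morphism $t:T\to H^d$ of $\mathcal C$ with $F(t)$ injective, then it is the image of $F(\int^l_{H^d})\to F(H^d)$. A right $H$-Hopf module is a right $H$-module $(X,a)$ and right $H$-comodule $(X,c)$ in $\mathcal C$ with $c\,a=(a\otimes m)(X\otimes C_{H,H}\otimes H)(c\otimes\Delta)$. -/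

import Mathlib

open CategoryTheory MonoidalCategory MonObj ComonObj HopfObj BraidedCategory
open scoped TensorProduct

universe w v u

namespace BraidedIntegral

section Categorical

variable {C : Type u} [Category.{v} C] [MonoidalCategory C] [BraidedCategory C]

/-- `N` is a left quasi-dual of the braided Hopf algebra `H` under `p = ⟨ , ⟩ : N ⊗ H ⟶ 𝟙`:
`⟨ , ⟩ (m ⊗ H) = (⟨ , ⟩ ⊗ ⟨ , ⟩)(N ⊗ C_{N,H} ⊗ H)(N ⊗ N ⊗ Δ)` and `⟨η, H⟩ = ε`. -/
structure IsQuasiDual (H N : C) [HopfObj H] [MonObj N] (p : N ⊗ H ⟶ 𝟙_ C) : Prop where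
  mul_pair : μ[N] ▷ H ≫ p =
    (N ⊗ N) ◁ Δ[H] ≫ tensorμ N N H H ≫ (p ⊗ₘ p) ≫ (λ_ (𝟙_ C)).hom
  one_pair : η[N] ▷ H ≫ p = (λ_ H).hom ≫ ε[H]

/-- `N` is a faithful quasi-dual of `H` under `p`. -/
structure IsFaithfulQuasiDual (H N : C) [HopfObj H] [MonObj N] (p : N ⊗ H ⟶ 𝟙_ C) : Prop
    extends IsQuasiDual H N p where
  faithful_left : ∀ {U V : C} (f f' : U ⟶ V ⊗ N),
    f ▷ H ≫ (α_ V N H).hom ≫ V ◁ p = f' ▷ H ≫ (α_ V N H).hom ≫ V ◁ p → f = f'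
  faithful_right : ∀ {U V : C} (g g' : U ⟶ H ⊗ V),
    N ◁ g ≫ (α_ N H V).inv ≫ p ▷ V = N ◁ g' ≫ (α_ N H V).inv ≫ p ▷ V → g = g'

/-- `(M, a)` is a left module over the algebra `A`. -/
structure IsLeftModule (A M : C) [MonObj A] (a : A ⊗ M ⟶ M) : Prop where
  one_act : η[A] ▷ M ≫ a = (λ_ M).hom
  mul_act : μ[A] ▷ M ≫ a = (α_ A A M).hom ≫ A ◁ a ≫ a

/-- Module-comodule compatibility of `a : N ⊗ M ⟶ M` and `r : M ⟶ M ⊗ H`: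
`(M ⊗ ⟨ , ⟩)(C_{N,M} ⊗ H)(N ⊗ r) = a`. -/
def MCOM {H N M : C} (p : N ⊗ H ⟶ 𝟙_ C) (a : N ⊗ M ⟶ M) (r : M ⟶ M ⊗ H) : Prop :=
  N ◁ r ≫ (α_ N M H).inv ≫ (β_ N M).hom ▷ H ≫ (α_ M N H).hom ≫ M ◁ p ≫ (ρ_ M).hom = a

/-- `j : M ⟶ N` exhibits `(M, a)` as a submodule in `C` of the regular left module `N`, and this
submodule is rational by means of `r : M ⟶ M ⊗ H`. -/
structure IsRationalSubmodule {H N M : C} [MonObj N] (p : N ⊗ H ⟶ 𝟙_ C)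
    (j : M ⟶ N) (a : N ⊗ M ⟶ M) (r : M ⟶ M ⊗ H) : Prop where
  mono : Mono j
  isLeftModule : IsLeftModule N M a
  act_comp : a ≫ j = N ◁ j ≫ μ[N]
  mcom : MCOM p a r

/-- `i : R ⟶ N`, with `a` and `r`, is the maximal rational submodule of the regular module `N`:
it is a rational submodule and contains all rational submodules. -/
structure IsMaximalRationalSubmodule {H N R : C} [MonObj N] (p : N ⊗ H ⟶ 𝟙_ C)
    (i : R ⟶ N) (a : N ⊗ R ⟶ R) (r : R ⟶ R ⊗ H) : Prop
    extends IsRationalSubmodule p i a r where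
  greatest : ∀ {U : C} (j : U ⟶ N) (b : N ⊗ U ⟶ U) (s : U ⟶ U ⊗ H),
    IsRationalSubmodule p j b s → ∃ t : U ⟶ R, t ≫ i = j

/-- `l : H ⊗ N ⟶ N` is the action `⇀`:
`⟨ , ⟩ (⇀ ⊗ H) = ⟨ , ⟩ (N ⊗ m)(N ⊗ C_{H,H})(C_{H,N} ⊗ H)`. -/
def IsHit {H N : C} [HopfObj H] (p : N ⊗ H ⟶ 𝟙_ C) (l : H ⊗ N ⟶ N) : Prop :=
  l ▷ H ≫ p =
    (β_ H N).hom ▷ H ≫ (α_ N H H).hom ≫ N ◁ (β_ H H).hom ≫ N ◁ μ[H] ≫ p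

/-- The right action `↼ = ⇀ (S ⊗ R) C_{R,H}` obtained from `l : H ⊗ R ⟶ R`. -/
def antipodeAction {H R : C} [HopfObj H] (l : H ⊗ R ⟶ R) : R ⊗ H ⟶ R :=
  (β_ R H).hom ≫ 𝒮[H] ▷ R ≫ l

/-- `(X, a, c)` is a (right) `H`-Hopf module in `C`: a right module, a right comodule, and
`c a = (a ⊗ m)(X ⊗ C_{H,H} ⊗ H)(c ⊗ Δ)`. -/
structure IsHopfModule (H X : C) [HopfObj H] (a : X ⊗ H ⟶ X) (c : X ⟶ X ⊗ H) : Prop where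
  act_one : X ◁ η[H] ≫ a = (ρ_ X).hom
  act_mul : a ▷ H ≫ a = (α_ X H H).hom ≫ X ◁ μ[H] ≫ a
  coact_counit : c ≫ X ◁ ε[H] = (ρ_ X).inv
  coact_comul : c ≫ X ◁ Δ[H] = c ≫ c ▷ H ≫ (α_ X H H).hom
  act_coact : a ≫ c = (c ⊗ₘ Δ[H]) ≫ tensorμ X H H H ≫ (a ⊗ₘ μ[H])

/-- The action `V ⊗ m` on `V ⊗ H`. -/
def freeAct (H V : C) [HopfObj H] : (V ⊗ H) ⊗ H ⟶ V ⊗ H :=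
  (α_ V H H).hom ≫ V ◁ μ[H]

/-- The coaction `V ⊗ Δ` on `V ⊗ H`. -/
def freeCoact (H V : C) [HopfObj H] : V ⊗ H ⟶ (V ⊗ H) ⊗ H :=
  V ◁ Δ[H] ≫ (α_ V H H).inv

end Categorical

section Elements

variable {k : Type w} [Field k] {C : Type u} [Category.{v} C] [MonoidalCategory C]
  (F : C ⥤ ModuleCat.{w} k) [F.Monoidal]

/-- The `k`-linear map from (the vector space of) `N` to the dual space `H^*` given by `p`. -/
noncomputable def toDual {H N : C} (p : N ⊗ H ⟶ 𝟙_ C) :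
    F.obj N →ₗ[k] Module.Dual k (F.obj H) :=
  TensorProduct.curry
    (Functor.LaxMonoidal.μ F N H ≫ F.map p ≫ Functor.OplaxMonoidal.η F).hom

/-- The unit element of an algebra in `C`. -/
noncomputable def oneElt (A : C) [MonObj A] : F.obj A :=
  (Functor.LaxMonoidal.ε F ≫ F.map η[A]).hom (1 : k)

/-- The product of two elements of an algebra in `C`. -/
noncomputable def mulElt {A : C} [MonObj A] (x y : F.obj A) : F.obj A :=
  (Functor.LaxMonoidal.μ F A A ≫ F.map μ[A]).hom (x ⊗ₜ[k] y)

/-- The set of left integrals `{f ∈ N | g * f = g(1) f for every g ∈ N}`. -/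
def leftIntegrals {H N : C} [MonObj H] [MonObj N] (p : N ⊗ H ⟶ 𝟙_ C) : Set (F.obj N) :=
  {f | ∀ g : F.obj N, mulElt F g f = toDual F p g (oneElt F H) • f}

/-- `e : J ⟶ N` is the space of left integrals as an object of `C`: the greatest subobject of `N`
in `C` all of whose elements are left integrals. -/
structure IsIntegralObject {H N J : C} [MonObj H] [MonObj N] (p : N ⊗ H ⟶ 𝟙_ C)
    (e : J ⟶ N) : Prop where
  mono : Mono e
  range_subset : Set.range (F.map e).hom ⊆ leftIntegrals F p
  greatest : ∀ {U : C} (f : U ⟶ N), Mono f →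
    Set.range (F.map f).hom ⊆ leftIntegrals F p → ∃ t : U ⟶ J, t ≫ e = f

end Elements

end BraidedIntegral

/-! Write f ↼ h for S(h) ⇀ f, so that ⟨f ↼ h, x⟩ = ⟨f, x S(h)⟩. Sweedler notation below leaves the
braidings implicit.

Hopf module structure. By faithfulness of the pairing, maps into R ⊗ H may be compared after pairing
the H-leg with H^d, and this pairing turns the coaction back into the action. Associativity and unit
of the action thus give coassociativity and counit. The compatibility of ↼ with the coaction becomes
g * (f ↼ h) = ((h₂ ⇀ g) * f) ↼ h₁ (`pair_coact_act`, `mul_antipodeHit_pairT`). Evaluated at x, this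
is the Hopf algebra identity (x S(h₁))₂ ⊗ (x S(h₁))₁ h₂ = x₂ S(h) ⊗ x₁ (`antipodeMul_cop_mul`). The
symmetry of C_{H,H} lets the extra crossings cancel, and faithfulness transfers it to H^d and H
(`braiding_eq_inv`).

Freeness. In a Hopf module x ↦ x₀ S(x₁) lands in the coinvariants, and (x₀ S(x₁)) x₂ = x; hence the
module is free on its coinvariants (`exists_iso_free`), which here form an equalizer.

Integrals. A subobject of H^d consists of left integrals exactly when H^d acts on it through g ↦
g(1). Such a subobject is rational with coaction u ↦ u ⊗ 1, so it factors through the maximal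
rational submodule and lands in its coinvariants (`isIntegralObject`). -/

namespace BraidedIntegral

/-! ### Calculus of right-nested tensor words: each operation acts at the front and carries an
arbitrary tail. -/

section Tails

variable {C : Type u} [Category.{v} C] [MonoidalCategory C]

/-- A morphism `X ⊗ Y ⟶ W` acting on the first two factors of a right-nested tensor word. -/
def mergeT {X Y W : C} (f : X ⊗ Y ⟶ W) (Z : C) : X ⊗ (Y ⊗ Z) ⟶ W ⊗ Z :=
  (α_ X Y Z).inv ≫ f ▷ Z

/-- A morphism `W ⟶ X ⊗ Y` acting on the first factor of a right-nested tensor word. -/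
def splitT {W X Y : C} (f : W ⟶ X ⊗ Y) (Z : C) : W ⊗ Z ⟶ X ⊗ (Y ⊗ Z) :=
  f ▷ Z ≫ (α_ X Y Z).hom

/-- A pairing `X ⊗ Y ⟶ 𝟙` acting on the first two factors of a right-nested tensor word. -/
def pairT {X Y : C} (p : X ⊗ Y ⟶ 𝟙_ C) (Z : C) : X ⊗ (Y ⊗ Z) ⟶ Z :=
  (α_ X Y Z).inv ≫ p ▷ Z ≫ (λ_ Z).hom

/-- Insertion of a point `𝟙 ⟶ X` in front of a tensor word. -/
def pointT {X : C} (f : 𝟙_ C ⟶ X) (Z : C) : Z ⟶ X ⊗ Z :=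
  (λ_ Z).inv ≫ f ▷ Z

/-- A copoint `X ⟶ 𝟙` applied to the first factor of a tensor word. -/
def copointT {X : C} (f : X ⟶ 𝟙_ C) (Z : C) : X ⊗ Z ⟶ Z :=
  f ▷ Z ≫ (λ_ Z).hom

variable {X Y W Z Z' : C}

theorem mergeT_nat (f : X ⊗ Y ⟶ W) (g : Z ⟶ Z') :
    mergeT f Z ≫ W ◁ g = X ◁ Y ◁ g ≫ mergeT f Z' := by
  simp [mergeT, ← whisker_exchange]

theorem mergeT_nat_assoc (f : X ⊗ Y ⟶ W) (g : Z ⟶ Z') {V : C} (h : W ⊗ Z' ⟶ V) :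
    mergeT f Z ≫ W ◁ g ≫ h = X ◁ Y ◁ g ≫ mergeT f Z' ≫ h := by
  rw [← Category.assoc, mergeT_nat, Category.assoc]

theorem splitT_nat (f : W ⟶ X ⊗ Y) (g : Z ⟶ Z') :
    splitT f Z ≫ X ◁ Y ◁ g = W ◁ g ≫ splitT f Z' := by
  simp [splitT, whisker_exchange_assoc]

theorem splitT_nat_assoc (f : W ⟶ X ⊗ Y) (g : Z ⟶ Z') {V : C} (h : X ⊗ Y ⊗ Z' ⟶ V) :
    splitT f Z ≫ X ◁ Y ◁ g ≫ h = W ◁ g ≫ splitT f Z' ≫ h := by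
  rw [← Category.assoc, splitT_nat, Category.assoc]

theorem pairT_nat (p : X ⊗ Y ⟶ 𝟙_ C) (g : Z ⟶ Z') :
    pairT p Z ≫ g = X ◁ Y ◁ g ≫ pairT p Z' := by
  rw [pairT, pairT, Category.assoc, Category.assoc, ← leftUnitor_naturality,
    ← whisker_exchange_assoc, associator_inv_naturality_right_assoc]

theorem pointT_nat (f : 𝟙_ C ⟶ X) (g : Z ⟶ Z') :
    pointT f Z ≫ X ◁ g = g ≫ pointT f Z' := by
  simp [pointT, ← whisker_exchange]

theorem pointT_nat_assoc (f : 𝟙_ C ⟶ X) (g : Z ⟶ Z') {V : C} (h : X ⊗ Z' ⟶ V) :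
    pointT f Z ≫ X ◁ g ≫ h = g ≫ pointT f Z' ≫ h := by
  rw [← Category.assoc, pointT_nat, Category.assoc]

theorem copointT_nat (f : X ⟶ 𝟙_ C) (g : Z ⟶ Z') :
    copointT f Z ≫ g = X ◁ g ≫ copointT f Z' := by
  simp [copointT, whisker_exchange_assoc]

theorem mergeT_mul_assoc (A Z : C) [MonObj A] :
    A ◁ mergeT μ[A] Z ≫ mergeT μ[A] Z = mergeT μ[A] (A ⊗ Z) ≫ mergeT μ[A] Z := by
  calc _ = 𝟙 _ ⊗≫ ((α_ A A A).hom ≫ A ◁ μ[A] ≫ μ[A]) ▷ Z := by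
        simp only [mergeT]; monoidal
    _ = _ := by
        rw [← MonObj.mul_assoc]
        simp only [mergeT]; monoidal

end Tails

/-! ### Crossings of adjacent strands and their naturality. -/

section Swaps

variable {C : Type u} [Category.{v} C] [MonoidalCategory C] [BraidedCategory C]

/-- The braiding of the first two factors of a right-nested tensor word. -/
def swapT (X Y Z : C) : X ⊗ (Y ⊗ Z) ⟶ Y ⊗ (X ⊗ Z) :=
  (α_ X Y Z).inv ≫ (β_ X Y).hom ▷ Z ≫ (α_ Y X Z).hom

/-- The inverse braiding of the first two factors of a right-nested tensor word. -/
def unswapT (X Y Z : C) : X ⊗ (Y ⊗ Z) ⟶ Y ⊗ (X ⊗ Z) :=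
  (α_ X Y Z).inv ≫ (β_ Y X).inv ▷ Z ≫ (α_ Y X Z).hom

theorem unswapT_swapT (X Y Z : C) : unswapT X Y Z ≫ swapT Y X Z = 𝟙 _ := by
  simp [swapT, unswapT]

variable {X Y W U Z Z' : C}

theorem swapT_nat (g : Z ⟶ Z') :
    swapT X Y Z ≫ Y ◁ X ◁ g = X ◁ Y ◁ g ≫ swapT X Y Z' := by
  rw [swapT, swapT, Category.assoc, Category.assoc, ← associator_naturality_right,
    ← whisker_exchange_assoc, associator_inv_naturality_right_assoc]

theorem swapT_nat_assoc (g : Z ⟶ Z') {V : C} (h : Y ⊗ X ⊗ Z' ⟶ V) :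
    swapT X Y Z ≫ Y ◁ X ◁ g ≫ h = X ◁ Y ◁ g ≫ swapT X Y Z' ≫ h := by
  rw [← Category.assoc, swapT_nat, Category.assoc]

theorem unswapT_nat (g : Z ⟶ Z') :
    unswapT X Y Z ≫ Y ◁ X ◁ g = X ◁ Y ◁ g ≫ unswapT X Y Z' := by
  rw [unswapT, unswapT, Category.assoc, Category.assoc, ← associator_naturality_right,
    ← whisker_exchange_assoc, associator_inv_naturality_right_assoc]

theorem swapT_left (f : X ⟶ W) : f ▷ (Y ⊗ Z) ≫ swapT W Y Z = swapT X Y Z ≫ Y ◁ f ▷ Z := by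
  calc _ = 𝟙 _ ⊗≫ (f ▷ Y ≫ (β_ W Y).hom) ▷ Z ⊗≫ 𝟙 _ := by simp only [swapT]; monoidal
    _ = _ := by rw [braiding_naturality_left]; simp only [swapT]; monoidal

theorem swapT_right (f : X ⟶ W) : Y ◁ f ▷ Z ≫ swapT Y W Z = swapT Y X Z ≫ f ▷ (Y ⊗ Z) := by
  calc _ = 𝟙 _ ⊗≫ (Y ◁ f ≫ (β_ Y W).hom) ▷ Z ⊗≫ 𝟙 _ := by simp only [swapT]; monoidal
    _ = _ := by rw [braiding_naturality_right]; simp only [swapT]; monoidal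

theorem unswapT_left (f : X ⟶ W) :
    f ▷ (Y ⊗ Z) ≫ unswapT W Y Z = unswapT X Y Z ≫ Y ◁ f ▷ Z := by
  calc _ = 𝟙 _ ⊗≫ (f ▷ Y ≫ (β_ Y W).inv) ▷ Z ⊗≫ 𝟙 _ := by simp only [unswapT]; monoidal
    _ = _ := by rw [braiding_inv_naturality_left]; simp only [unswapT]; monoidal

theorem mergeT_swapT (f : X ⊗ Y ⟶ W) :
    mergeT f (U ⊗ Z) ≫ swapT W U Z =
      X ◁ swapT Y U Z ≫ swapT X U (Y ⊗ Z) ≫ U ◁ mergeT f Z := by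
  calc _ = 𝟙 _ ⊗≫ (f ▷ U ≫ (β_ W U).hom) ▷ Z ⊗≫ 𝟙 _ := by
        simp only [swapT, mergeT]; monoidal
    _ = _ := by
        rw [braiding_naturality_left, braiding_tensor_left_hom]
        simp only [swapT, mergeT]; monoidal

theorem whisker_mergeT_swapT (f : X ⊗ Y ⟶ W) :
    U ◁ mergeT f Z ≫ swapT U W Z =
      swapT U X (Y ⊗ Z) ≫ X ◁ swapT U Y Z ≫ mergeT f (U ⊗ Z) := by
  calc _ = 𝟙 _ ⊗≫ (U ◁ f ≫ (β_ U W).hom) ▷ Z ⊗≫ 𝟙 _ := by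
        simp only [swapT, mergeT]; monoidal
    _ = _ := by
        rw [braiding_naturality_right, braiding_tensor_right_hom]
        simp only [swapT, mergeT]; monoidal

theorem swapT_whisker_splitT (f : W ⟶ X ⊗ Y) :
    swapT W U Z ≫ U ◁ splitT f Z =
      splitT f (U ⊗ Z) ≫ X ◁ swapT Y U Z ≫ swapT X U (Y ⊗ Z) := by
  calc _ = 𝟙 _ ⊗≫ ((β_ W U).hom ≫ U ◁ f) ▷ Z ⊗≫ 𝟙 _ := by
        simp only [swapT, splitT]; monoidal
    _ = _ := by
        rw [← braiding_naturality_left, braiding_tensor_left_hom]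
        simp only [swapT, splitT]; monoidal

theorem swapT_splitT (f : W ⟶ X ⊗ Y) :
    swapT U W Z ≫ splitT f (U ⊗ Z) =
      U ◁ splitT f Z ≫ swapT U X (Y ⊗ Z) ≫ X ◁ swapT U Y Z := by
  calc _ = 𝟙 _ ⊗≫ ((β_ U W).hom ≫ f ▷ U) ▷ Z ⊗≫ 𝟙 _ := by
        simp only [swapT, splitT]; monoidal
    _ = _ := by
        rw [← braiding_naturality_right, braiding_tensor_right_hom]
        simp only [swapT, splitT]; monoidal

/-- Naturality of the braiding in `p`: the braiding with the unit object is trivial, so a strand may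
be pulled across a pairing. -/
theorem pairT_swapT (p : X ⊗ Y ⟶ 𝟙_ C) :
    pairT p (U ⊗ Z) = X ◁ swapT Y U Z ≫ swapT X U (Y ⊗ Z) ≫ U ◁ pairT p Z := by
  calc _ = 𝟙 _ ⊗≫ (p ▷ U ≫ (β_ (𝟙_ C) U).hom) ▷ Z ⊗≫ 𝟙 _ := by
        rw [braiding_tensorUnit_left]; simp only [pairT]; monoidal
    _ = _ := by
        rw [braiding_naturality_left, braiding_tensor_left_hom]
        simp only [swapT, pairT]; monoidal

theorem whisker_pairT (p : X ⊗ Y ⟶ 𝟙_ C) :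
    U ◁ pairT p Z = swapT U X (Y ⊗ Z) ≫ X ◁ swapT U Y Z ≫ pairT p (U ⊗ Z) := by
  calc _ = 𝟙 _ ⊗≫ (U ◁ p ≫ (β_ U (𝟙_ C)).hom) ▷ Z ⊗≫ 𝟙 _ := by
        rw [braiding_tensorUnit_right]; simp only [pairT]; monoidal
    _ = _ := by
        rw [braiding_naturality_right, braiding_tensor_right_hom]
        simp only [swapT, pairT]; monoidal

theorem pointT_swapT (f : 𝟙_ C ⟶ X) :
    pointT f (Y ⊗ Z) ≫ swapT X Y Z = Y ◁ pointT f Z := by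
  calc _ = 𝟙 _ ⊗≫ (f ▷ Y ≫ (β_ X Y).hom) ▷ Z ⊗≫ 𝟙 _ := by
        simp only [swapT, pointT]; monoidal
    _ = _ := by
        rw [braiding_naturality_left, braiding_tensorUnit_left]
        simp only [pointT]; monoidal

theorem swapT_whisker_copointT (f : X ⟶ 𝟙_ C) :
    swapT X Y Z ≫ Y ◁ copointT f Z = copointT f (Y ⊗ Z) := by
  calc _ = 𝟙 _ ⊗≫ ((β_ X Y).hom ≫ Y ◁ f) ▷ Z ⊗≫ 𝟙 _ := by
        simp only [swapT, copointT]; monoidal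
    _ = _ := by
        rw [← braiding_naturality_left, braiding_tensorUnit_left]
        simp only [copointT]; monoidal

theorem swapT_yang_baxter (X Y W Z : C) :
    swapT X Y (W ⊗ Z) ≫ Y ◁ swapT X W Z ≫ swapT Y W (X ⊗ Z) =
      X ◁ swapT Y W Z ≫ swapT X W (Y ⊗ Z) ≫ W ◁ swapT X Y Z := by
  have h := yang_baxter X Y W
  calc _ = 𝟙 _ ⊗≫ ((α_ X Y W).inv ≫ (β_ X Y).hom ▷ W ≫ (α_ Y X W).hom ≫
        Y ◁ (β_ X W).hom ≫ (α_ Y W X).inv ≫ (β_ Y W).hom ▷ X ≫ (α_ W Y X).hom) ▷ Z ⊗≫ 𝟙 _ := by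
        simp only [swapT]; monoidal
    _ = _ := by
        rw [yang_baxter]
        simp only [swapT]; monoidal

end Swaps

/-! ### Hopf algebra axioms and antipode identities with a tail. -/

section HopfTails

variable {C : Type u} [Category.{v} C] [MonoidalCategory C] [BraidedCategory C]
  (H : C) [HopfObj H] (Z : C)

theorem pointT_mul : pointT η[H] (H ⊗ Z) ≫ mergeT μ[H] Z = 𝟙 _ := by
  calc _ = 𝟙 _ ⊗≫ (η[H] ▷ H ≫ μ[H]) ▷ Z := by simp only [pointT, mergeT]; monoidal
    _ = _ := by rw [MonObj.one_mul]; monoidal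

theorem whisker_pointT_mul : H ◁ pointT η[H] Z ≫ mergeT μ[H] Z = 𝟙 _ := by
  calc _ = 𝟙 _ ⊗≫ (H ◁ η[H] ≫ μ[H]) ▷ Z := by simp only [pointT, mergeT]; monoidal
    _ = _ := by rw [MonObj.mul_one]; monoidal

theorem splitT_comul_assoc :
    splitT Δ[H] Z ≫ splitT Δ[H] (H ⊗ Z) = splitT Δ[H] Z ≫ H ◁ splitT Δ[H] Z := by
  calc _ = (Δ[H] ≫ Δ[H] ▷ H) ▷ Z ⊗≫ 𝟙 _ := by simp only [splitT]; monoidal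
    _ = _ := by rw [ComonObj.comul_assoc_flip]; simp only [splitT]; monoidal

theorem splitT_counit : splitT Δ[H] Z ≫ copointT ε[H] (H ⊗ Z) = 𝟙 _ := by
  calc _ = (Δ[H] ≫ ε[H] ▷ H) ▷ Z ⊗≫ 𝟙 _ := by simp only [splitT, copointT]; monoidal
    _ = _ := by rw [ComonObj.counit_comul]; monoidal

theorem splitT_whisker_counit : splitT Δ[H] Z ≫ H ◁ copointT ε[H] Z = 𝟙 _ := by
  calc _ = (Δ[H] ≫ H ◁ ε[H]) ▷ Z ⊗≫ 𝟙 _ := by simp only [splitT, copointT]; monoidal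
    _ = _ := by rw [ComonObj.comul_counit]; monoidal

theorem splitT_antipode_left :
    splitT Δ[H] Z ≫ 𝒮[H] ▷ (H ⊗ Z) ≫ mergeT μ[H] Z = copointT ε[H] Z ≫ pointT η[H] Z := by
  calc _ = (Δ[H] ≫ 𝒮[H] ▷ H ≫ μ[H]) ▷ Z := by simp only [splitT, mergeT]; monoidal
    _ = _ := by rw [antipode_left]; simp [copointT, pointT]

theorem splitT_antipode_right :
    splitT Δ[H] Z ≫ H ◁ 𝒮[H] ▷ Z ≫ mergeT μ[H] Z = copointT ε[H] Z ≫ pointT η[H] Z := by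
  calc _ = (Δ[H] ≫ H ◁ 𝒮[H] ≫ μ[H]) ▷ Z := by simp only [splitT, mergeT]; monoidal
    _ = _ := by rw [antipode_right]; simp [copointT, pointT]

theorem mergeT_splitT :
    mergeT μ[H] Z ≫ splitT Δ[H] Z =
      splitT Δ[H] (H ⊗ Z) ≫ H ◁ H ◁ splitT Δ[H] Z ≫ H ◁ swapT H H (H ⊗ Z) ≫
        mergeT μ[H] (H ⊗ H ⊗ Z) ≫ H ◁ mergeT μ[H] Z := by
  calc _ = 𝟙 _ ⊗≫ (μ[H] ≫ Δ[H]) ▷ Z ⊗≫ 𝟙 _ := by simp only [splitT, mergeT]; monoidal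
    _ = _ := by
        rw [BimonObj.mul_comul, MonoidalCategory.tensorHom_def, MonoidalCategory.tensorHom_def]
        simp only [splitT, mergeT, swapT, tensorμ]; monoidal

theorem mergeT_antipode :
    mergeT μ[H] Z ≫ 𝒮[H] ▷ Z =
      𝒮[H] ▷ (H ⊗ Z) ≫ H ◁ 𝒮[H] ▷ Z ≫ swapT H H Z ≫ mergeT μ[H] Z := by
  calc _ = 𝟙 _ ⊗≫ (μ[H] ≫ 𝒮[H]) ▷ Z ⊗≫ 𝟙 _ := by simp only [mergeT]; monoidal
    _ = _ := by
        rw [mul_antipode, MonoidalCategory.tensorHom_def]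
        simp only [mergeT, swapT]; monoidal

theorem antipode_splitT :
    𝒮[H] ▷ Z ≫ splitT Δ[H] Z =
      splitT Δ[H] Z ≫ swapT H H Z ≫ 𝒮[H] ▷ (H ⊗ Z) ≫ H ◁ 𝒮[H] ▷ Z := by
  calc _ = 𝟙 _ ⊗≫ (𝒮[H] ≫ Δ[H]) ▷ Z ⊗≫ 𝟙 _ := by simp only [splitT]; monoidal
    _ = _ := by
        rw [antipode_comul, MonoidalCategory.tensorHom_def]
        simp only [splitT, swapT]; monoidal

theorem pointT_antipode : pointT η[H] Z ≫ 𝒮[H] ▷ Z = pointT η[H] Z := by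
  rw [pointT, Category.assoc, ← comp_whiskerRight, one_antipode]

/-- The left action `h ⊗ x ↦ x S(h)` of a Hopf algebra on itself. -/
def antipodeMul : H ⊗ H ⟶ H := 𝒮[H] ▷ H ≫ (β_ H H).hom ≫ μ[H]

theorem mergeT_antipodeMul :
    mergeT (antipodeMul H) Z = 𝒮[H] ▷ (H ⊗ Z) ≫ swapT H H Z ≫ mergeT μ[H] Z := by
  simp only [antipodeMul, mergeT, swapT]; monoidal

theorem pointT_antipodeMul : pointT η[H] (H ⊗ Z) ≫ mergeT (antipodeMul H) Z = 𝟙 _ := by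
  rw [mergeT_antipodeMul, reassoc_of% (pointT_antipode H (H ⊗ Z)), reassoc_of% (pointT_swapT η[H]),
    whisker_pointT_mul]

theorem antipodeMul_assoc :
    H ◁ mergeT (antipodeMul H) Z ≫ mergeT (antipodeMul H) Z =
      mergeT μ[H] (H ⊗ Z) ≫ mergeT (antipodeMul H) Z := by
  simp only [mergeT_antipodeMul, whiskerLeft_comp, Category.assoc]
  rw [reassoc_of% (mergeT_antipode H (H ⊗ Z)), reassoc_of% (mergeT_swapT (U := H) (Z := Z) μ[H]),
    mergeT_mul_assoc]
  rw [whisker_exchange_assoc, whisker_exchange_assoc, whisker_exchange_assoc,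
    reassoc_of% (whisker_mergeT_swapT (U := H) (Z := Z) μ[H]),
    ← reassoc_of% (swapT_yang_baxter H H H Z)]

end HopfTails

/-! ### Identities for h ⊗ x ↦ x S(h) when the self-braiding of H is symmetric. -/

section SymmetricHopf

variable {C : Type u} [Category.{v} C] [MonoidalCategory C] [BraidedCategory C]

theorem swapT_swapT {X Y : C} (h : (β_ X Y).hom = (β_ Y X).inv) (Z : C) :
    swapT X Y Z ≫ swapT Y X Z = 𝟙 _ := by
  simp [swapT, h]

variable (H : C) [HopfObj H] (Z : C)

/-- Sweedler form: Δ(x S(h)) = x₁ S(h₂) ⊗ x₂ S(h₁), since S reverses Δ. Symmetry removes one double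
crossing. -/
theorem antipodeMul_comul (hs : (β_ H H).hom = (β_ H H).inv) :
    mergeT (antipodeMul H) Z ≫ splitT Δ[H] Z =
      splitT Δ[H] (H ⊗ Z) ≫ swapT H H (H ⊗ Z) ≫ H ◁ H ◁ splitT Δ[H] Z ≫
        H ◁ swapT H H (H ⊗ Z) ≫ mergeT (antipodeMul H) (H ⊗ H ⊗ Z) ≫
          H ◁ mergeT (antipodeMul H) Z := by
  have e₁ := congrArg (H ◁ ·) (swapT_whisker_splitT (U := H) (Z := Z) Δ[H])
  have e₂ := congrArg (H ◁ ·) (swapT_swapT hs (H ⊗ Z))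
  have e₃ := congrArg (H ◁ ·) (swapT_left (Y := H) (Z := H ⊗ Z) 𝒮[H])
  have e₄ := congrArg (H ◁ ·) (whisker_exchange 𝒮[H] (splitT Δ[H] Z))
  simp only [whiskerLeft_comp, whiskerLeft_id] at e₁ e₂ e₃ e₄
  simp only [mergeT_antipodeMul, Category.assoc, whiskerLeft_comp]
  rw [mergeT_splitT, reassoc_of% (swapT_splitT (U := H) (Z := Z) Δ[H]), reassoc_of% e₁,
    reassoc_of% e₂, reassoc_of% (swapT_whisker_splitT (U := H) (Z := H ⊗ Z) Δ[H]),
    ← splitT_nat_assoc, reassoc_of% (antipode_splitT H (H ⊗ Z)),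
    mergeT_nat_assoc, mergeT_nat_assoc, swapT_nat_assoc (Z := H ⊗ H ⊗ Z),
    ← whisker_exchange_assoc, ← whisker_exchange_assoc, ← whisker_exchange_assoc,
    ← whisker_exchange_assoc, ← reassoc_of% e₄, reassoc_of% e₃]
  simp only [whisker_exchange_assoc]
  rw [swapT_nat_assoc (𝒮[H] ▷ (H ⊗ Z)), swapT_nat_assoc (swapT H H Z)]

theorem antipodeMul_swapT :
    mergeT (antipodeMul H) (H ⊗ H ⊗ Z) ≫ H ◁ mergeT (antipodeMul H) Z ≫ swapT H H Z =
      H ◁ swapT H H (H ⊗ Z) ≫ H ◁ H ◁ swapT H H Z ≫ swapT H H (H ⊗ H ⊗ Z) ≫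
        H ◁ swapT H H (H ⊗ Z) ≫
        mergeT (antipodeMul H) (H ⊗ H ⊗ Z) ≫ H ◁ mergeT (antipodeMul H) Z := by
  have e₁ := congrArg (H ◁ ·) (mergeT_swapT (U := H) (Z := Z) (antipodeMul H))
  simp only [whiskerLeft_comp] at e₁
  rw [whisker_mergeT_swapT, reassoc_of% (mergeT_swapT (U := H) (Z := H ⊗ Z) (antipodeMul H)),
    reassoc_of% e₁, mergeT_nat, swapT_nat_assoc]

theorem antipodeMul_cop (hs : (β_ H H).hom = (β_ H H).inv) :
    mergeT (antipodeMul H) Z ≫ splitT Δ[H] Z ≫ swapT H H Z =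
      splitT Δ[H] (H ⊗ Z) ≫ H ◁ H ◁ splitT Δ[H] Z ≫ H ◁ H ◁ swapT H H Z ≫
        H ◁ swapT H H (H ⊗ Z) ≫ mergeT (antipodeMul H) (H ⊗ H ⊗ Z) ≫
          H ◁ mergeT (antipodeMul H) Z := by
  have e₂ := congrArg (H ◁ ·) (swapT_swapT hs (H ⊗ Z))
  simp only [whiskerLeft_comp, whiskerLeft_id] at e₂
  rw [reassoc_of% (antipodeMul_comul H Z hs), antipodeMul_swapT, reassoc_of% e₂,
    ← swapT_nat_assoc, ← swapT_nat_assoc, reassoc_of% (swapT_swapT hs)]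

/-- This is x S(h₁) h₂ = ε(h) x. -/
theorem comul_antipodeMul_mul :
    splitT Δ[H] (H ⊗ Z) ≫ H ◁ swapT H H Z ≫ mergeT (antipodeMul H) (H ⊗ Z) ≫ mergeT μ[H] Z =
      copointT ε[H] (H ⊗ Z) := by
  rw [mergeT_antipodeMul, Category.assoc, Category.assoc, ← mergeT_mul_assoc,
    whisker_exchange_assoc, ← reassoc_of% (mergeT_swapT (U := H) (Z := Z) μ[H]),
    reassoc_of% (splitT_antipode_left H (H ⊗ Z)), reassoc_of% (pointT_swapT η[H]),
    whisker_pointT_mul, Category.comp_id]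

/-- The cancellation v S(h₁) h₂ = ε(h) v in the presence of a spectator strand. Yang–Baxter brings
the two legs of h next to each other, where their crossings cancel by symmetry. -/
theorem comul_swapT_counit (hs : (β_ H H).hom = (β_ H H).inv) :
    splitT Δ[H] (H ⊗ H ⊗ Z) ≫ swapT H H (H ⊗ H ⊗ Z) ≫ H ◁ swapT H H (H ⊗ Z) ≫
      swapT H H (H ⊗ H ⊗ Z) ≫ H ◁ swapT H H (H ⊗ Z) ≫ H ◁ H ◁ swapT H H Z ≫
      H ◁ mergeT (antipodeMul H) (H ⊗ Z) ≫ H ◁ mergeT μ[H] Z =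
    copointT ε[H] (H ⊗ H ⊗ Z) := by
  have e := congrArg (H ◁ ·) (comul_antipodeMul_mul H Z)
  simp only [whiskerLeft_comp] at e
  rw [← reassoc_of% (swapT_yang_baxter H H H (H ⊗ Z)), reassoc_of% (swapT_swapT hs),
    ← reassoc_of% (swapT_whisker_splitT (U := H) (Z := H ⊗ Z) Δ[H]), e, swapT_whisker_copointT]

/-- The left side expands to x₂ S(h₁) ⊗ x₁ S(h₂) h₃, and the last two legs of h cancel. This is the
dual form of the compatibility of action and coaction. -/
theorem antipodeMul_cop_mul (hs : (β_ H H).hom = (β_ H H).inv) :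
    splitT Δ[H] (H ⊗ Z) ≫ swapT H H (H ⊗ Z) ≫
      H ◁ mergeT (antipodeMul H) Z ≫ H ◁ splitT Δ[H] Z ≫ H ◁ swapT H H Z ≫
      swapT H H (H ⊗ Z) ≫ H ◁ swapT H H Z ≫ H ◁ mergeT μ[H] Z =
    H ◁ splitT Δ[H] Z ≫ H ◁ swapT H H Z ≫ mergeT (antipodeMul H) (H ⊗ Z) := by
  have e₁ := congrArg (H ◁ ·) (antipodeMul_cop H Z hs)
  have e₂ := congrArg (H ◁ ·) (whisker_mergeT_swapT (U := H) (Z := Z) (antipodeMul H))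
  have e₃ := congrArg (H ◁ ·) (comul_swapT_counit H Z hs)
  have e₄ := congrArg (H ◁ ·) (splitT_nat (X := H) Δ[H] (splitT Δ[H] Z))
  have e₅ := congrArg (H ◁ ·) (splitT_nat (X := H) Δ[H] (swapT H H Z))
  have e₆ := congrArg (H ◁ ·) (swapT_nat (X := H) (Y := H) (splitT Δ[H] Z))
  have e₇ := congrArg (H ◁ ·) (swapT_nat (X := H) (Y := H) (swapT H H Z))
  simp only [whiskerLeft_comp] at e₁ e₂ e₃ e₄ e₅ e₆ e₇
  rw [reassoc_of% e₁, ← swapT_nat_assoc,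
    reassoc_of% (whisker_mergeT_swapT (U := H) (Z := H ⊗ H ⊗ Z) (antipodeMul H)),
    reassoc_of% e₂]
  rw [reassoc_of% (swapT_whisker_splitT (U := H) (Z := H ⊗ Z) Δ[H]),
    reassoc_of% (splitT_comul_assoc H (H ⊗ Z)), swapT_nat_assoc, swapT_nat_assoc, swapT_nat_assoc,
    reassoc_of% (swapT_swapT hs)]
  simp only [mergeT_nat_assoc, mergeT_nat]
  rw [reassoc_of% e₆, reassoc_of% e₇, reassoc_of% e₄, reassoc_of% e₅, reassoc_of% e₃,
    splitT_nat_assoc, splitT_nat_assoc, reassoc_of% (splitT_whisker_counit H)]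

end SymmetricHopf

/-! ### Consequences of the faithful pairing, and the twisted action on the quasi-dual. -/

section Pairing

variable {C : Type u} [Category.{v} C] [MonoidalCategory C] [BraidedCategory C]
  {H N : C} {p : N ⊗ H ⟶ 𝟙_ C}

theorem swapT_whisker_pairT (hs : (β_ H H).hom = (β_ H H).inv) (Z : C) :
    swapT N H (H ⊗ Z) ≫ H ◁ pairT p Z = N ◁ swapT H H Z ≫ pairT p (H ⊗ Z) := by
  have e := congrArg (N ◁ ·) (swapT_swapT hs Z)
  simp only [whiskerLeft_comp, whiskerLeft_id] at e
  rw [pairT_swapT, reassoc_of% e]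

/-- Unlike `swapT_whisker_pairT`, this holds for any braiding. Comparing the two right-hand sides
yields the symmetry between N and H. -/
theorem unswapT_whisker_pairT (Z : C) :
    unswapT N H (H ⊗ Z) ≫ H ◁ pairT p Z = N ◁ swapT H H Z ≫ pairT p (H ⊗ Z) := by
  rw [whisker_pairT, reassoc_of% (unswapT_swapT N H)]

namespace IsFaithfulQuasiDual

variable [HopfObj H] [MonObj N]

/-- If `H` braids symmetrically with itself, it braids symmetrically with its quasi-dual. -/
theorem braiding_eq_inv (hp : IsFaithfulQuasiDual H N p) (hs : (β_ H H).hom = (β_ H H).inv) :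
    (β_ N H).hom = (β_ H N).inv := by
  refine hp.faithful_left _ _ ?_
  -- Either crossing of N with H, followed by pairing N with a second copy of H, gives the same
  -- morphism.
  have h := (swapT_whisker_pairT hs (𝟙_ C)).trans (unswapT_whisker_pairT (p := p) (𝟙_ C)).symm
  calc _ = 𝟙 _ ⊗≫ (swapT N H (H ⊗ 𝟙_ C) ≫ H ◁ pairT p (𝟙_ C)) ⊗≫ 𝟙 _ := by
        simp only [swapT, pairT]; monoidal
    _ = _ := by rw [h]; simp only [unswapT, pairT]; monoidal

theorem hom_ext (hp : IsFaithfulQuasiDual H N p) {U : C} {f f' : U ⟶ N}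
    (h : ∀ Z, f ▷ (H ⊗ Z) ≫ pairT p Z = f' ▷ (H ⊗ Z) ≫ pairT p Z) : f = f' := by
  rw [← cancel_mono (λ_ N).inv]
  refine hp.faithful_left _ _ ?_
  calc _ = 𝟙 _ ⊗≫ (f ▷ (H ⊗ 𝟙_ C) ≫ pairT p (𝟙_ C)) ⊗≫ 𝟙 _ := by
        simp only [pairT]; monoidal
    _ = _ := by rw [h]; simp only [pairT]; monoidal

/-- Faithfulness is given for H on the left of V. Composing with an inverse braiding moves H there,
and `key` identifies the resulting test with the one occurring in `MCOM`. -/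
theorem hom_ext_right (hp : IsFaithfulQuasiDual H N p) {U V : C} {g g' : U ⟶ V ⊗ H}
    (h : N ◁ splitT g (𝟙_ C) ≫ swapT N V (H ⊗ 𝟙_ C) ≫ V ◁ pairT p (𝟙_ C) =
      N ◁ splitT g' (𝟙_ C) ≫ swapT N V (H ⊗ 𝟙_ C) ≫ V ◁ pairT p (𝟙_ C)) : g = g' := by
  have key (Z) : N ◁ unswapT V H Z ≫ pairT p (V ⊗ Z) = swapT N V (H ⊗ Z) ≫ V ◁ pairT p Z := by
    rw [pairT_swapT, ← whiskerLeft_comp_assoc, unswapT_swapT, whiskerLeft_id, Category.id_comp]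
  simp only [← key] at h
  rw [← cancel_mono (β_ H V).inv]
  refine hp.faithful_right _ _ ?_
  calc _ = 𝟙 _ ⊗≫ (N ◁ splitT g (𝟙_ C) ≫ N ◁ unswapT V H (𝟙_ C) ≫ pairT p (V ⊗ 𝟙_ C)) ⊗≫ 𝟙 _ := by
        simp only [pairT, unswapT, splitT]; monoidal
    _ = _ := by rw [h]; simp only [pairT, unswapT, splitT]; monoidal

/-- Two applications of `hom_ext_right`, one for each H-leg. -/
theorem hom_ext_right₂ (hp : IsFaithfulQuasiDual H N p) {U V : C} {g g' : U ⟶ V ⊗ (H ⊗ H)}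
    (h : ∀ Z, N ◁ N ◁ (splitT g Z ≫ V ◁ (α_ H H Z).hom) ≫ N ◁ swapT N V (H ⊗ H ⊗ Z) ≫
        N ◁ V ◁ swapT N H (H ⊗ Z) ≫ N ◁ V ◁ H ◁ pairT p Z ≫ swapT N V (H ⊗ Z) ≫ V ◁ pairT p Z =
      N ◁ N ◁ (splitT g' Z ≫ V ◁ (α_ H H Z).hom) ≫ N ◁ swapT N V (H ⊗ H ⊗ Z) ≫
        N ◁ V ◁ swapT N H (H ⊗ Z) ≫ N ◁ V ◁ H ◁ pairT p Z ≫ swapT N V (H ⊗ Z) ≫ V ◁ pairT p Z) :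
    g = g' := by
  have key (g : U ⟶ V ⊗ (H ⊗ H)) :
      splitT ((N ◁ splitT (g ≫ (α_ V H H).inv) (𝟙_ C) ≫ swapT N (V ⊗ H) (H ⊗ 𝟙_ C) ≫
        (V ⊗ H) ◁ pairT p (𝟙_ C)) ≫ (ρ_ (V ⊗ H)).hom) (𝟙_ C) =
      𝟙 _ ⊗≫ N ◁ (splitT g (𝟙_ C) ≫ V ◁ (α_ H H (𝟙_ C)).hom) ≫ swapT N V (H ⊗ H ⊗ 𝟙_ C) ≫
        V ◁ swapT N H (H ⊗ 𝟙_ C) ≫ V ◁ H ◁ pairT p (𝟙_ C) := by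
    simp only [splitT, swapT, pairT, braiding_tensor_right_hom]; monoidal
  rw [← cancel_mono (α_ V H H).inv]
  apply hp.hom_ext_right
  rw [← cancel_mono (ρ_ (V ⊗ H)).hom]
  apply hp.hom_ext_right
  rw [key, key]
  have := h (𝟙_ C)
  simp only [monoidalComp, whiskerLeft_comp, Category.assoc] at this ⊢
  rw [this]

theorem mergeT_pairT (hp : IsFaithfulQuasiDual H N p) (Z : C) :
    mergeT μ[N] (H ⊗ Z) ≫ pairT p Z =
      N ◁ N ◁ splitT Δ[H] Z ≫ N ◁ swapT N H (H ⊗ Z) ≫ pairT p (N ⊗ H ⊗ Z) ≫ pairT p Z := by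
  calc _ = 𝟙 _ ⊗≫ (μ[N] ▷ H ≫ p) ▷ Z ⊗≫ 𝟙 _ := by simp only [mergeT, pairT]; monoidal
    _ = _ := by
      rw [hp.mul_pair, MonoidalCategory.tensorHom_def]
      simp only [splitT, pairT, swapT, tensorμ]; monoidal

theorem pointT_pairT (hp : IsFaithfulQuasiDual H N p) (Z : C) :
    pointT η[N] (H ⊗ Z) ≫ pairT p Z = copointT ε[H] Z := by
  calc _ = 𝟙 _ ⊗≫ (η[N] ▷ H ≫ p) ▷ Z ⊗≫ 𝟙 _ := by simp only [pointT, pairT]; monoidal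
    _ = _ := by rw [hp.one_pair]; simp only [copointT]; monoidal

/-- Symmetry allows the pairings in ⟨g, x₁⟩⟨f, x₂⟩ to be nested, so that no strand of N has to cross
H. -/
theorem mergeT_pairT_nested (hp : IsFaithfulQuasiDual H N p)
    (hs : (β_ H H).hom = (β_ H H).inv) (Z : C) :
    mergeT μ[N] (H ⊗ Z) ≫ pairT p Z =
      N ◁ N ◁ splitT Δ[H] Z ≫ N ◁ N ◁ swapT H H Z ≫ N ◁ pairT p (H ⊗ Z) ≫ pairT p Z := by
  have e := congrArg (N ◁ ·) (swapT_whisker_pairT (N := N) (p := p) hs Z)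
  simp only [whiskerLeft_comp] at e
  rw [hp.mergeT_pairT, pairT_nat, reassoc_of% e]

end IsFaithfulQuasiDual

variable [HopfObj H]

/-- The right-sided form `n ⊗ h ↦ S(h) ⇀ n` of the action `⇀` twisted by the antipode. -/
def antipodeHit (l : H ⊗ N ⟶ N) : N ⊗ H ⟶ N := N ◁ 𝒮[H] ≫ (β_ N H).hom ≫ l

/-- The definition of ⇀ contains C_{H,N}; the symmetry of N with H makes it cancel against the
braiding placed in front. -/
theorem mergeT_hit_pairT {l : H ⊗ N ⟶ N} (hl : IsHit p l)
    (hNH : (β_ N H).hom = (β_ H N).inv) (Z : C) :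
    mergeT ((β_ N H).hom ≫ l) (H ⊗ Z) ≫ pairT p Z =
      N ◁ swapT H H Z ≫ N ◁ mergeT μ[H] Z ≫ pairT p Z := by
  calc _ = 𝟙 _ ⊗≫ ((β_ N H).hom ▷ H ≫ l ▷ H ≫ p) ▷ Z ⊗≫ 𝟙 _ := by
        simp only [mergeT, pairT]; monoidal
    _ = _ := by
        rw [show l ▷ H ≫ p = _ from hl, hNH, inv_hom_whiskerRight_assoc]
        simp only [mergeT, pairT, swapT]; monoidal

theorem mergeT_antipodeHit (l : H ⊗ N ⟶ N) (Z : C) :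
    mergeT (antipodeHit l) Z = N ◁ 𝒮[H] ▷ Z ≫ mergeT ((β_ N H).hom ≫ l) Z := by
  simp only [antipodeHit, mergeT]; monoidal

theorem mergeT_antipodeHit_pairT {l : H ⊗ N ⟶ N} (hl : IsHit p l)
    (hNH : (β_ N H).hom = (β_ H N).inv) (Z : C) :
    mergeT (antipodeHit l) (H ⊗ Z) ≫ pairT p Z =
      N ◁ mergeT (antipodeMul H) Z ≫ pairT p Z := by
  rw [mergeT_antipodeHit, Category.assoc, mergeT_hit_pairT hl hNH, mergeT_antipodeMul]
  simp only [whiskerLeft_comp, Category.assoc]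

theorem antipodeAction_comp {R : C} {i : R ⟶ N} {l : H ⊗ N ⟶ N} {lR : H ⊗ R ⟶ R}
    (hlR : lR ≫ i = H ◁ i ≫ l) :
    antipodeAction lR ≫ i = i ▷ H ≫ antipodeHit l := by
  simp only [antipodeAction, antipodeHit, Category.assoc, hlR]
  rw [← whisker_exchange_assoc, ← braiding_naturality_left_assoc,
    ← braiding_naturality_right_assoc]

end Pairing

/-! ### Rational modules as comodules, and the two halves of the Hopf compatibility. -/

section RationalHopfModule

variable {C : Type u} [Category.{v} C] [MonoidalCategory C] {H N R : C}

theorem IsLeftModule.mul_act_tail [MonObj N] {a : N ⊗ R ⟶ R} (h : IsLeftModule N R a) (Z : C) :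
    mergeT μ[N] (R ⊗ Z) ≫ mergeT a Z = N ◁ mergeT a Z ≫ mergeT a Z := by
  calc _ = 𝟙 _ ⊗≫ (μ[N] ▷ R ≫ a) ▷ Z := by simp only [mergeT]; monoidal
    _ = _ := by rw [h.mul_act]; simp only [mergeT]; monoidal

theorem IsLeftModule.one_act_tail [MonObj N] {a : N ⊗ R ⟶ R} (h : IsLeftModule N R a) (Z : C) :
    pointT η[N] (R ⊗ Z) ≫ mergeT a Z = 𝟙 _ := by
  calc _ = 𝟙 _ ⊗≫ (η[N] ▷ R ≫ a) ▷ Z := by simp only [mergeT, pointT]; monoidal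
    _ = _ := by rw [h.one_act]; monoidal

variable [BraidedCategory C]

theorem MCOM.tail {p : N ⊗ H ⟶ 𝟙_ C} {a : N ⊗ R ⟶ R} {r : R ⟶ R ⊗ H} (h : MCOM p a r) (Z : C) :
    N ◁ splitT r Z ≫ swapT N R (H ⊗ Z) ≫ R ◁ pairT p Z = mergeT a Z := by
  rw [← show _ = a from h]
  simp only [splitT, swapT, pairT, mergeT]; monoidal

theorem IsRationalSubmodule.act_comp_tail [MonObj N] {p : N ⊗ H ⟶ 𝟙_ C} {i : R ⟶ N}
    {a : N ⊗ R ⟶ R} {r : R ⟶ R ⊗ H} (h : IsRationalSubmodule p i a r) (Z : C) :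
    mergeT a Z ≫ i ▷ Z = N ◁ i ▷ Z ≫ mergeT μ[N] Z := by
  calc _ = 𝟙 _ ⊗≫ (a ≫ i) ▷ Z := by simp only [mergeT]; monoidal
    _ = _ := by rw [h.act_comp]; simp only [mergeT]; monoidal

theorem whisker_splitT_swapT (hs : (β_ H H).hom = (β_ H H).inv) (r : R ⟶ R ⊗ H) (Z : C) :
    H ◁ splitT r Z ≫ swapT H R (H ⊗ Z) =
      swapT H R Z ≫ splitT r (H ⊗ Z) ≫ R ◁ swapT H H Z := by
  have e := congrArg (R ◁ ·) (swapT_swapT hs Z)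
  simp only [whiskerLeft_comp, whiskerLeft_id] at e
  rw [reassoc_of% (swapT_splitT (U := H) (Z := Z) r), e, Category.comp_id]

variable [HopfObj H]

theorem coact_counit_of_mcom [MonObj N] {p : N ⊗ H ⟶ 𝟙_ C} (hp : IsFaithfulQuasiDual H N p)
    {a : N ⊗ R ⟶ R} {r : R ⟶ R ⊗ H} (ha : IsLeftModule N R a) (hr : MCOM p a r) :
    r ≫ R ◁ ε[H] = (ρ_ R).inv := by
  have h : splitT r (𝟙_ C) ≫ R ◁ copointT ε[H] (𝟙_ C) = 𝟙 _ := by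
    rw [← ha.one_act_tail, ← hr.tail, pointT_nat_assoc, reassoc_of% (pointT_swapT η[N]),
      ← whiskerLeft_comp, hp.pointT_pairT]
  calc _ = 𝟙 _ ⊗≫ (splitT r (𝟙_ C) ≫ R ◁ copointT ε[H] (𝟙_ C)) ⊗≫ 𝟙 _ := by
        simp only [splitT, copointT]; monoidal
    _ = _ := by rw [h]; monoidal

/-- Paired with two elements of N, the two sides become (g * g') · x and g · (g' · x). -/
theorem coact_comul_of_mcom [MonObj N] {p : N ⊗ H ⟶ 𝟙_ C} (hp : IsFaithfulQuasiDual H N p)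
    {a : N ⊗ R ⟶ R} {r : R ⟶ R ⊗ H} (ha : IsLeftModule N R a) (hr : MCOM p a r) :
    r ≫ R ◁ Δ[H] = r ≫ r ▷ H ≫ (α_ R H H).hom := by
  refine hp.hom_ext_right₂ fun Z ↦ ?_
  have h₁ : splitT (r ≫ R ◁ Δ[H]) Z ≫ R ◁ (α_ H H Z).hom = splitT r Z ≫ R ◁ splitT Δ[H] Z := by
    simp only [splitT]; monoidal
  have h₂ : splitT (r ≫ r ▷ H ≫ (α_ R H H).hom) Z ≫ R ◁ (α_ H H Z).hom =
      splitT r Z ≫ splitT r (H ⊗ Z) := by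
    simp only [splitT]; monoidal
  have e₁ := congrArg (N ◁ ·) (hr.tail Z)
  have e₂ := congrArg (N ◁ ·) (swapT_splitT (U := N) (Z := H ⊗ Z) r)
  have e₃ := congrArg (N ◁ ·) (splitT_nat r (pairT p Z))
  have e₄ := congrArg (N ◁ ·) (swapT_nat (X := N) (Y := R) (splitT Δ[H] Z))
  have e₅ := congrArg (R ◁ ·) (hp.mergeT_pairT Z)
  rw [pairT_nat] at e₅
  simp only [whiskerLeft_comp] at e₁ e₂ e₃ e₄ e₅
  rw [h₁, h₂]
  simp only [whiskerLeft_comp, Category.assoc]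
  rw [← reassoc_of% e₂, reassoc_of% e₃, reassoc_of% e₁, hr.tail, ← reassoc_of% e₄,
    ← swapT_nat_assoc, ← swapT_nat_assoc, ← swapT_nat_assoc]
  rw [← e₅, ← reassoc_of% (mergeT_swapT (U := R) (Z := H ⊗ Z) μ[N]), ← mergeT_nat_assoc,
    hr.tail, ha.mul_act_tail]

theorem antipodeHit_act_one [MonObj N] {p : N ⊗ H ⟶ 𝟙_ C} (hp : IsFaithfulQuasiDual H N p)
    (hNH : (β_ N H).hom = (β_ H N).inv)
    {l : H ⊗ N ⟶ N} (hl : IsHit p l) :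
    N ◁ η[H] ≫ antipodeHit l = (ρ_ N).hom := by
  rw [← cancel_epi (ρ_ N).inv]
  refine hp.hom_ext fun Z ↦ ?_
  calc _ = N ◁ pointT η[H] (H ⊗ Z) ≫ mergeT (antipodeHit l) (H ⊗ Z) ≫ pairT p Z := by
        simp only [pointT, mergeT]; monoidal
    _ = _ := by
      rw [mergeT_antipodeHit_pairT hl hNH, ← whiskerLeft_comp_assoc, pointT_antipodeMul]; simp

theorem antipodeHit_act_mul [MonObj N] {p : N ⊗ H ⟶ 𝟙_ C} (hp : IsFaithfulQuasiDual H N p)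
    (hNH : (β_ N H).hom = (β_ H N).inv)
    {l : H ⊗ N ⟶ N} (hl : IsHit p l) :
    antipodeHit l ▷ H ≫ antipodeHit l = (α_ N H H).hom ≫ N ◁ μ[H] ≫ antipodeHit l := by
  rw [← cancel_epi (α_ N H H).inv]
  refine hp.hom_ext fun Z ↦ ?_
  calc _ = 𝟙 _ ⊗≫ (mergeT (antipodeHit l) (H ⊗ H ⊗ Z) ≫ mergeT (antipodeHit l) (H ⊗ Z) ≫
            pairT p Z) := by
        simp only [mergeT]; monoidal
    _ = 𝟙 _ ⊗≫ (N ◁ mergeT μ[H] (H ⊗ Z) ≫ mergeT (antipodeHit l) (H ⊗ Z) ≫ pairT p Z) := by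
        rw [mergeT_antipodeHit_pairT hl hNH, mergeT_nat_assoc, mergeT_antipodeHit_pairT hl hNH,
          ← whiskerLeft_comp_assoc, antipodeMul_assoc, whiskerLeft_comp_assoc]
    _ = _ := by simp only [mergeT]; monoidal

/-- In Sweedler form, (f₀ h₁)⟨g, f₁ h₂⟩ = ((h₂ ⇀ g) · f) h₁ for the action `b`, because ⟨g, f₁ h₂⟩ =
⟨h₂ ⇀ g, f₁⟩. The inverse crossing of R with H is what cancels the crossing that arises when H
passes the coaction; no symmetry between R and H is assumed. -/
theorem pair_coact_act (hs : (β_ H H).hom = (β_ H H).inv) {p : N ⊗ H ⟶ 𝟙_ C}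
    (hNH : (β_ N H).hom = (β_ H N).inv) {l : H ⊗ N ⟶ N} (hl : IsHit p l)
    {a : N ⊗ R ⟶ R} {r : R ⟶ R ⊗ H} (hr : MCOM p a r) (b : R ⊗ H ⟶ R) (Z : C) :
    N ◁ splitT r (H ⊗ Z) ≫ N ◁ R ◁ H ◁ splitT Δ[H] Z ≫ N ◁ R ◁ swapT H H (H ⊗ Z) ≫
      N ◁ mergeT b (H ⊗ H ⊗ Z) ≫ N ◁ R ◁ mergeT μ[H] Z ≫ swapT N R (H ⊗ Z) ≫ R ◁ pairT p Z =
    N ◁ R ◁ splitT Δ[H] Z ≫ N ◁ R ◁ swapT H H Z ≫ N ◁ unswapT R H (H ⊗ Z) ≫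
      mergeT ((β_ N H).hom ≫ l) (R ⊗ H ⊗ Z) ≫ mergeT a (H ⊗ Z) ≫ mergeT b Z := by
  have e₁ := congrArg (N ◁ ·) (mergeT_nat b (mergeT μ[H] Z))
  have e₂ := congrArg (R ◁ ·) (swapT_whisker_pairT (N := N) (p := p) hs Z)
  have e₃ := congrArg (R ◁ N ◁ ·) (whisker_mergeT_swapT (U := H) (Z := Z) μ[H])
  have e₄ := congrArg (R ◁ N ◁ ·) (swapT_swapT hs (H ⊗ Z))
  have e₅ := congrArg (R ◁ ·) (mergeT_hit_pairT hl hNH (H ⊗ Z))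
  have e₆ := congrArg (N ◁ ·) (whisker_splitT_swapT hs r (H ⊗ Z))
  have e₇ := congrArg (N ◁ ·) (unswapT_swapT R H (H ⊗ Z))
  have e₈ := congrArg (N ◁ ·) (splitT_nat r (splitT Δ[H] Z))
  have e₉ := congrArg (N ◁ ·) (splitT_nat r (swapT H H Z))
  simp only [whiskerLeft_comp, whiskerLeft_id] at e₁ e₂ e₃ e₄ e₅ e₆ e₇ e₈ e₉
  rw [reassoc_of% e₁, reassoc_of% (whisker_mergeT_swapT (U := N) (Z := H ⊗ Z) b), mergeT_nat,
    reassoc_of% e₂, ← swapT_nat_assoc, ← swapT_nat_assoc, ← swapT_nat_assoc, reassoc_of% e₃,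
    reassoc_of% e₄]
  rw [← hr.tail (H ⊗ Z)]
  simp only [Category.assoc]
  rw [mergeT_nat_assoc, reassoc_of% (mergeT_swapT (U := R) (Z := H ⊗ H ⊗ Z) ((β_ N H).hom ≫ l)),
    reassoc_of% e₅, reassoc_of% e₆, reassoc_of% e₇, ← reassoc_of% e₉, ← reassoc_of% e₈,
    ← swapT_nat_assoc (swapT H H (H ⊗ Z)), reassoc_of% e₄, swapT_nat_assoc, swapT_nat_assoc]

/-- The identity ((h₂ ⇀ g) * f) ↼ h₁ = g * (f ↼ h), evaluated on H. Moving every operation to the H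
side leaves `antipodeMul_cop_mul`. -/
theorem mul_antipodeHit_pairT (hs : (β_ H H).hom = (β_ H H).inv) [MonObj N] {p : N ⊗ H ⟶ 𝟙_ C}
    (hp : IsFaithfulQuasiDual H N p)
    (hNH : (β_ N H).hom = (β_ H N).inv) {l : H ⊗ N ⟶ N} (hl : IsHit p l) (Z : C) :
    N ◁ N ◁ splitT Δ[H] (H ⊗ Z) ≫ N ◁ N ◁ swapT H H (H ⊗ Z) ≫ N ◁ unswapT N H (H ⊗ H ⊗ Z) ≫
      mergeT ((β_ N H).hom ≫ l) (N ⊗ H ⊗ H ⊗ Z) ≫ mergeT μ[N] (H ⊗ H ⊗ Z) ≫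
      mergeT (antipodeHit l) (H ⊗ Z) ≫ pairT p Z =
    N ◁ mergeT (antipodeHit l) (H ⊗ Z) ≫ mergeT μ[N] (H ⊗ Z) ≫ pairT p Z := by
  have e₁ := congrArg (N ◁ ·) (unswapT_whisker_pairT (N := N) (p := p) (H ⊗ Z))
  have e₂ := congrArg (N ◁ N ◁ ·) (antipodeMul_cop_mul H Z hs)
  have e₃ := congrArg (N ◁ ·) (mergeT_antipodeHit_pairT hl hNH (H ⊗ Z))
  have n₁ {W W' : C} (g : W ⟶ W') :=
    congrArg (N ◁ ·) (mergeT_nat (antipodeHit l) g)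
  have n₂ {W W' : C} (g : W ⟶ W') :=
    congrArg (N ◁ ·) (unswapT_nat (X := N) (Y := H) g)
  have n₃ {W W' : C} (g : W ⟶ W') := congrArg (N ◁ ·) (pairT_nat p g)
  simp only [whiskerLeft_comp] at e₁ e₂ e₃ n₁ n₂ n₃
  rw [hp.mergeT_pairT_nested hs, reassoc_of% n₁, reassoc_of% n₁, reassoc_of% e₃,
    mergeT_antipodeHit_pairT hl hNH, mergeT_nat_assoc, hp.mergeT_pairT_nested hs,
    mergeT_nat_assoc, mergeT_nat_assoc, mergeT_nat_assoc, mergeT_nat_assoc,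
    mergeT_hit_pairT hl hNH, reassoc_of% n₂, reassoc_of% n₂, reassoc_of% n₂, reassoc_of% e₁,
    reassoc_of% n₃, reassoc_of% n₃, reassoc_of% e₂]

end RationalHopfModule

/-! ### The rational submodule as a Hopf module. -/

section RationalPart

variable {C : Type u} [Category.{v} C] [MonoidalCategory C] [BraidedCategory C]
  {H N R : C} [HopfObj H] {p : N ⊗ H ⟶ 𝟙_ C}
  {i : R ⟶ N} {a : N ⊗ R ⟶ R} {r : R ⟶ R ⊗ H} {l : H ⊗ N ⟶ N} {lR : H ⊗ R ⟶ R}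

theorem mergeT_antipodeAction_comp (hlR : lR ≫ i = H ◁ i ≫ l) (Z : C) :
    mergeT (antipodeAction lR) Z ≫ i ▷ Z = i ▷ (H ⊗ Z) ≫ mergeT (antipodeHit l) Z := by
  calc _ = 𝟙 _ ⊗≫ (antipodeAction lR ≫ i) ▷ Z := by simp only [mergeT]; monoidal
    _ = _ := by rw [antipodeAction_comp hlR]; simp only [mergeT]; monoidal

variable [MonObj N]

theorem antipodeAction_coact (hs : (β_ H H).hom = (β_ H H).inv)
    (hp : IsFaithfulQuasiDual H N p) (hR : IsRationalSubmodule p i a r) (hl : IsHit p l)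
    (hlR : lR ≫ i = H ◁ i ≫ l) :
    antipodeAction lR ≫ r =
      (r ⊗ₘ Δ[H]) ≫ tensorμ R H H H ≫ (antipodeAction lR ⊗ₘ μ[H]) := by
  have hNH := hp.braiding_eq_inv hs
  have := hR.mono
  set b := antipodeAction lR with hb
  have tail (Z) : N ◁ mergeT b (H ⊗ Z) ≫ N ◁ splitT r (H ⊗ Z) ≫ swapT N R (H ⊗ H ⊗ Z) ≫
      R ◁ pairT p (H ⊗ Z) ≫ i ▷ (H ⊗ Z) ≫ pairT p Z =
      N ◁ splitT r (H ⊗ H ⊗ Z) ≫ N ◁ R ◁ H ◁ splitT Δ[H] (H ⊗ Z) ≫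
      N ◁ R ◁ swapT H H (H ⊗ H ⊗ Z) ≫ N ◁ mergeT b (H ⊗ H ⊗ H ⊗ Z) ≫
      N ◁ R ◁ mergeT μ[H] (H ⊗ Z) ≫ swapT N R (H ⊗ H ⊗ Z) ≫ R ◁ pairT p (H ⊗ Z) ≫
      i ▷ (H ⊗ Z) ≫ pairT p Z := by
    have e₁ := congrArg (N ◁ ·) (mergeT_antipodeAction_comp (i := i) hlR (H ⊗ Z))
    have e₂ := congrArg (N ◁ ·) (unswapT_left (Y := H) (Z := H ⊗ H ⊗ Z) i)
    have e₃ := congrArg (N ◁ ·) (whisker_exchange i (splitT Δ[H] (H ⊗ Z)))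
    have e₄ := congrArg (N ◁ ·) (whisker_exchange i (swapT H H (H ⊗ Z)))
    simp only [whiskerLeft_comp, ← hb] at e₁ e₂ e₃ e₄
    -- The left side becomes g * (f ↼ h) and the right side ((h₂ ⇀ g) * f) ↼ h₁, both in N and
    -- paired with H.
    rw [reassoc_of% (hR.mcom.tail (H ⊗ Z)), reassoc_of% (hR.act_comp_tail (H ⊗ Z)),
      reassoc_of% e₁, reassoc_of% (pair_coact_act hs hNH hl hR.mcom b (H ⊗ Z)),
      reassoc_of% (mergeT_antipodeAction_comp (i := i) hlR (H ⊗ Z)),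
      reassoc_of% (hR.act_comp_tail (H ⊗ H ⊗ Z)), mergeT_nat_assoc, ← reassoc_of% e₂,
      reassoc_of% e₄, reassoc_of% e₃, mul_antipodeHit_pairT hs hp hNH hl]
  -- The equality is tested by pairing the coaction leg with N, then embedding R in N and pairing
  -- with H.
  apply hp.hom_ext_right
  rw [← cancel_mono (ρ_ R).hom, ← cancel_mono i]
  refine hp.hom_ext fun Z ↦ ?_
  calc _ = 𝟙 _ ⊗≫ (N ◁ mergeT b (H ⊗ Z) ≫ N ◁ splitT r (H ⊗ Z) ≫ swapT N R (H ⊗ H ⊗ Z) ≫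
      R ◁ pairT p (H ⊗ Z) ≫ i ▷ (H ⊗ Z) ≫ pairT p Z) := by
        simp only [mergeT, splitT, swapT, pairT]; monoidal
    _ = _ := by
        rw [tail]
        simp only [mergeT, splitT, swapT, pairT, tensorμ, MonoidalCategory.tensorHom_def]; monoidal

/-- A rational submodule stable under `⇀` is a right Hopf module. -/
theorem IsRationalSubmodule.isHopfModule (hs : (β_ H H).hom = (β_ H H).inv)
    (hp : IsFaithfulQuasiDual H N p) (hR : IsRationalSubmodule p i a r) (hl : IsHit p l)
    (hlR : lR ≫ i = H ◁ i ≫ l) : IsHopfModule H R (antipodeAction lR) r where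
  act_one := by
    have := hR.mono
    rw [← cancel_mono i, Category.assoc, antipodeAction_comp hlR, whisker_exchange_assoc,
      antipodeHit_act_one hp (hp.braiding_eq_inv hs) hl, rightUnitor_naturality]
  act_mul := by
    have := hR.mono
    rw [← cancel_mono i]
    simp only [Category.assoc]
    rw [antipodeAction_comp hlR, ← comp_whiskerRight_assoc, antipodeAction_comp hlR,
      comp_whiskerRight_assoc, antipodeHit_act_mul hp (hp.braiding_eq_inv hs) hl,
      whisker_exchange_assoc, associator_naturality_left_assoc]
  coact_counit := coact_counit_of_mcom hp hR.isLeftModule hR.mcom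
  coact_comul := coact_comul_of_mcom hp hR.isLeftModule hR.mcom
  act_coact := antipodeAction_coact hs hp hR hl hlR

end RationalPart

/-! ### Hopf modules over H, for an arbitrary braiding. -/

section FundamentalTheorem

variable {C : Type u} [Category.{v} C] [MonoidalCategory C] [BraidedCategory C]

theorem isHopfModule_free (H V : C) [HopfObj H] :
    IsHopfModule H (V ⊗ H) (freeAct H V) (freeCoact H V) where
  act_one := by
    calc _ = 𝟙 _ ⊗≫ V ◁ (H ◁ η[H] ≫ μ[H]) := by simp only [freeAct]; monoidal
      _ = _ := by rw [MonObj.mul_one]; monoidal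
  act_mul := by
    calc _ = 𝟙 _ ⊗≫ V ◁ (μ[H] ▷ H ≫ μ[H]) := by simp only [freeAct]; monoidal
      _ = _ := by rw [MonObj.mul_assoc]; simp only [freeAct]; monoidal
  coact_counit := by
    calc _ = V ◁ (Δ[H] ≫ H ◁ ε[H]) ⊗≫ 𝟙 _ := by simp only [freeCoact]; monoidal
      _ = _ := by rw [ComonObj.comul_counit]; monoidal
  coact_comul := by
    calc _ = V ◁ (Δ[H] ≫ H ◁ Δ[H]) ⊗≫ 𝟙 _ := by simp only [freeCoact]; monoidal
      _ = _ := by rw [ComonObj.comul_assoc]; simp only [freeCoact]; monoidal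
  act_coact := by
    calc _ = 𝟙 _ ⊗≫ V ◁ (μ[H] ≫ Δ[H]) ⊗≫ 𝟙 _ := by simp only [freeAct, freeCoact]; monoidal
      _ = _ := by
        rw [BimonObj.mul_comul]
        simp only [freeAct, freeCoact, tensorμ, MonoidalCategory.tensorHom_def]; monoidal

variable {H X : C} [HopfObj H] {a : X ⊗ H ⟶ X} {c : X ⟶ X ⊗ H}

/-- The endomorphism `x ↦ x₀ S(x₁)` of a Hopf module. -/
def coinvariantProj (a : X ⊗ H ⟶ X) (c : X ⟶ X ⊗ H) : X ⟶ X := c ≫ X ◁ 𝒮[H] ≫ a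

theorem coinvariantProj_whiskerRight (a : X ⊗ H ⟶ X) (c : X ⟶ X ⊗ H) (Z : C) :
    coinvariantProj a c ▷ Z = splitT c Z ≫ X ◁ 𝒮[H] ▷ Z ≫ mergeT a Z := by
  simp only [coinvariantProj, splitT, mergeT]; monoidal

namespace IsHopfModule

theorem act_one_tail (hX : IsHopfModule H X a c) (Z : C) :
    X ◁ pointT η[H] Z ≫ mergeT a Z = 𝟙 _ := by
  calc _ = 𝟙 _ ⊗≫ (X ◁ η[H] ≫ a) ▷ Z := by simp only [pointT, mergeT]; monoidal
    _ = _ := by rw [hX.act_one]; monoidal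

theorem act_mul_tail (hX : IsHopfModule H X a c) (Z : C) :
    mergeT a (H ⊗ Z) ≫ mergeT a Z = X ◁ mergeT μ[H] Z ≫ mergeT a Z := by
  calc _ = 𝟙 _ ⊗≫ (a ▷ H ≫ a) ▷ Z := by simp only [mergeT]; monoidal
    _ = _ := by rw [hX.act_mul]; simp only [mergeT]; monoidal

theorem coact_counit_tail (hX : IsHopfModule H X a c) (Z : C) :
    splitT c Z ≫ X ◁ copointT ε[H] Z = 𝟙 _ := by
  calc _ = (c ≫ X ◁ ε[H]) ▷ Z ⊗≫ 𝟙 _ := by simp only [splitT, copointT]; monoidal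
    _ = _ := by rw [hX.coact_counit]; monoidal

theorem coact_comul_tail (hX : IsHopfModule H X a c) (Z : C) :
    splitT c Z ≫ splitT c (H ⊗ Z) = splitT c Z ≫ X ◁ splitT Δ[H] Z := by
  calc _ = (c ≫ c ▷ H ≫ (α_ X H H).hom) ▷ Z ⊗≫ 𝟙 _ := by simp only [splitT]; monoidal
    _ = _ := by rw [← hX.coact_comul]; simp only [splitT]; monoidal

theorem act_coact_tail (hX : IsHopfModule H X a c) (Z : C) :
    mergeT a Z ≫ splitT c Z =
      splitT c (H ⊗ Z) ≫ X ◁ H ◁ splitT Δ[H] Z ≫ X ◁ swapT H H (H ⊗ Z) ≫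
        mergeT a (H ⊗ H ⊗ Z) ≫ X ◁ mergeT μ[H] Z := by
  calc _ = 𝟙 _ ⊗≫ (a ≫ c) ▷ Z ⊗≫ 𝟙 _ := by simp only [mergeT, splitT]; monoidal
    _ = _ := by
      rw [hX.act_coact]
      simp only [mergeT, splitT, swapT, tensorμ, MonoidalCategory.tensorHom_def]; monoidal

/-- The coaction sends x₀ S(x₁) to x₀ S(x₃) ⊗ x₁ S(x₂), and the inner legs cancel, leaving x₀ S(x₁)
⊗ 1. -/
theorem coinvariantProj_coact_tail (hX : IsHopfModule H X a c) (Z : C) :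
    coinvariantProj a c ▷ Z ≫ splitT c Z = coinvariantProj a c ▷ Z ≫ X ◁ pointT η[H] Z := by
  have e₁ := congrArg (X ◁ H ◁ ·) (antipode_splitT H Z)
  have e₂ := congrArg (X ◁ ·) (splitT_comul_assoc H Z)
  have e₃ := congrArg (X ◁ ·) (swapT_nat (X := H) (Y := H) (𝒮[H] ▷ Z))
  have e₄ := congrArg (X ◁ ·) (swapT_right (Y := H) (Z := H ⊗ Z) 𝒮[H])
  have e₅ := congrArg (X ◁ ·) (swapT_whisker_splitT (U := H) (Z := Z) Δ[H])
  have e₆ := congrArg (X ◁ ·) (whisker_exchange 𝒮[H] (H ◁ 𝒮[H] ▷ Z))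
  have e₇ := congrArg (X ◁ ·) (whisker_exchange 𝒮[H] (mergeT μ[H] Z))
  have e₈ := congrArg (X ◁ H ◁ ·) (splitT_antipode_right H Z)
  have e₉ := congrArg (X ◁ ·) (swapT_whisker_copointT (Y := H) (Z := Z) ε[H])
  have e₁₀ := congrArg (X ◁ ·) (splitT_counit H Z)
  have e₁₁ := congrArg (X ◁ ·) (whisker_exchange 𝒮[H] (pointT η[H] Z))
  simp only [whiskerLeft_comp, whiskerLeft_id] at e₁ e₂ e₃ e₄ e₅ e₆ e₇ e₈ e₉ e₁₀ e₁₁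
  simp only [coinvariantProj_whiskerRight, Category.assoc]
  rw [hX.act_coact_tail, ← splitT_nat_assoc, reassoc_of% e₁, reassoc_of% hX.coact_comul_tail,
    ← reassoc_of% e₂, ← reassoc_of% e₃, reassoc_of% e₄, ← reassoc_of% e₅, mergeT_nat,
    ← reassoc_of% e₆, ← reassoc_of% e₇, reassoc_of% e₈, reassoc_of% e₉, reassoc_of% e₁₀,
    mergeT_nat, ← reassoc_of% e₁₁]

/-- This is x₀ S(x₁) x₂ = x. -/
theorem coact_coinvariantProj_act_tail (hX : IsHopfModule H X a c) (Z : C) :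
    splitT c Z ≫ coinvariantProj a c ▷ (H ⊗ Z) ≫ mergeT a Z = 𝟙 _ := by
  have e := congrArg (X ◁ ·) (splitT_antipode_left H Z)
  simp only [whiskerLeft_comp] at e
  simp only [coinvariantProj_whiskerRight, Category.assoc]
  rw [reassoc_of% hX.coact_comul_tail, hX.act_mul_tail, reassoc_of% e,
    reassoc_of% hX.coact_counit_tail, hX.act_one_tail]

section Coinvariant

variable {J : C} {j : J ⟶ X}

theorem coinvariant_act_coact_tail (hX : IsHopfModule H X a c) (Z : C)
    (hj : j ≫ c = j ≫ (ρ_ X).inv ≫ X ◁ η[H]) :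
    j ▷ (H ⊗ Z) ≫ mergeT a Z ≫ splitT c Z =
      j ▷ (H ⊗ Z) ≫ X ◁ splitT Δ[H] Z ≫ mergeT a (H ⊗ Z) := by
  have h : j ▷ (H ⊗ Z) ≫ splitT c (H ⊗ Z) = j ▷ (H ⊗ Z) ≫ X ◁ pointT η[H] (H ⊗ Z) := by
    calc _ = (j ≫ c) ▷ (H ⊗ Z) ⊗≫ 𝟙 _ := by simp only [splitT]; monoidal
      _ = _ := by rw [hj]; simp only [pointT]; monoidal
  have e₁ := congrArg (X ◁ ·) (pointT_nat η[H] (splitT Δ[H] Z))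
  have e₂ := congrArg (X ◁ ·) (pointT_swapT (Y := H) (Z := H ⊗ Z) η[H])
  have e₃ := congrArg (X ◁ H ◁ ·) (pointT_mul H Z)
  simp only [whiskerLeft_comp, whiskerLeft_id] at e₁ e₂ e₃
  rw [hX.act_coact_tail, reassoc_of% h, reassoc_of% e₁, reassoc_of% e₂, mergeT_nat,
    reassoc_of% e₃]

/-- For v coinvariant, vh has coaction v h₁ ⊗ h₂, so its projection is v h₁ S(h₂) = ε(h) v. -/
theorem coinvariant_act_coinvariantProj_tail (hX : IsHopfModule H X a c) (Z : C)
    (hj : j ≫ c = j ≫ (ρ_ X).inv ≫ X ◁ η[H]) :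
    j ▷ (H ⊗ Z) ≫ mergeT a Z ≫ coinvariantProj a c ▷ Z =
      j ▷ (H ⊗ Z) ≫ X ◁ copointT ε[H] Z := by
  have e := congrArg (X ◁ ·) (splitT_antipode_right H Z)
  simp only [whiskerLeft_comp] at e
  rw [coinvariantProj_whiskerRight, reassoc_of% (hX.coinvariant_act_coact_tail Z hj),
    mergeT_nat_assoc, hX.act_mul_tail, reassoc_of% e, hX.act_one_tail, Category.comp_id]

end Coinvariant

end IsHopfModule

end FundamentalTheorem

/-! ### Freeness of a Hopf module on its coinvariants. -/

section Coinvariants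

variable {C : Type u} [Category.{v} C] [MonoidalCategory C] [BraidedCategory C]
  {H X : C} [HopfObj H] {a : X ⊗ H ⟶ X} {c : X ⟶ X ⊗ H}

namespace IsHopfModule

theorem coinvariantProj_coact (hX : IsHopfModule H X a c) :
    coinvariantProj a c ≫ c = coinvariantProj a c ≫ (ρ_ X).inv ≫ X ◁ η[H] := by
  calc _ = 𝟙 _ ⊗≫ (coinvariantProj a c ▷ (𝟙_ C) ≫ splitT c (𝟙_ C)) ⊗≫ 𝟙 _ := by
        simp only [splitT]; monoidal
    _ = _ := by rw [hX.coinvariantProj_coact_tail]; simp only [pointT]; monoidal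

/-- The fundamental theorem of Hopf modules: a Hopf module is free on its coinvariants. -/
theorem exists_iso_free (hX : IsHopfModule H X a c) {J : C} (j : J ⟶ X) [Mono j]
    (hj : j ≫ c = j ≫ (ρ_ X).inv ≫ X ◁ η[H])
    (hlift : ∃ q : X ⟶ J, q ≫ j = coinvariantProj a c) :
    ∃ φ : X ≅ J ⊗ H, a ≫ φ.hom = φ.hom ▷ H ≫ freeAct H J ∧
      c ≫ φ.hom ▷ H = φ.hom ≫ freeCoact H J := by
  obtain ⟨q, hq⟩ := hlift
  have hjaq : j ▷ H ≫ a ≫ q = J ◁ ε[H] ≫ (ρ_ J).hom := by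
    rw [← cancel_mono j]
    simp only [Category.assoc]
    rw [hq]
    calc _ = 𝟙 _ ⊗≫ (j ▷ (H ⊗ 𝟙_ C) ≫ mergeT a (𝟙_ C) ≫ coinvariantProj a c ▷ (𝟙_ C)) ⊗≫
          𝟙 _ := by simp only [mergeT]; monoidal
      _ = 𝟙 _ ⊗≫ (j ▷ H ≫ X ◁ ε[H]) ⊗≫ 𝟙 _ := by
          rw [hX.coinvariant_act_coinvariantProj_tail _ hj]; simp only [copointT]; monoidal
      _ = _ := by rw [← whisker_exchange]; monoidal
  have h₁ : (c ≫ q ▷ H) ≫ j ▷ H ≫ a = 𝟙 X := by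
    rw [Category.assoc, ← comp_whiskerRight_assoc, hq]
    calc _ = 𝟙 _ ⊗≫ (splitT c (𝟙_ C) ≫ coinvariantProj a c ▷ (H ⊗ 𝟙_ C) ≫
          mergeT a (𝟙_ C)) ⊗≫ 𝟙 _ := by simp only [splitT, mergeT]; monoidal
      _ = _ := by rw [hX.coact_coinvariantProj_act_tail]; monoidal
  have h₂ : (j ▷ H ≫ a) ≫ c ≫ q ▷ H = 𝟙 (J ⊗ H) := by
    calc _ = 𝟙 _ ⊗≫ (j ▷ (H ⊗ 𝟙_ C) ≫ mergeT a (𝟙_ C) ≫ splitT c (𝟙_ C)) ⊗≫ q ▷ H := by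
          simp only [splitT, mergeT]; monoidal
      _ = 𝟙 _ ⊗≫ (j ▷ H ≫ X ◁ Δ[H]) ⊗≫ (a ≫ q) ▷ H := by
          rw [hX.coinvariant_act_coact_tail _ hj]; simp only [splitT, mergeT]; monoidal
      _ = 𝟙 _ ⊗≫ J ◁ Δ[H] ⊗≫ (j ▷ H ≫ a ≫ q) ▷ H := by rw [← whisker_exchange]; monoidal
      _ = J ◁ (Δ[H] ≫ ε[H] ▷ H) ⊗≫ 𝟙 _ := by rw [hjaq]; monoidal
      _ = _ := by rw [ComonObj.counit_comul]; monoidal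
  -- Linearity is immediate for the inverse v ⊗ h ↦ vh; it transfers to x ↦ q(x₀) ⊗ x₁ by
  -- conjugation.
  have hψ : freeAct H J ≫ j ▷ H ≫ a = (j ▷ H ≫ a) ▷ H ≫ a := by
    rw [comp_whiskerRight, Category.assoc, hX.act_mul, freeAct, Category.assoc,
      whisker_exchange_assoc, associator_naturality_left_assoc]
  refine ⟨⟨c ≫ q ▷ H, j ▷ H ≫ a, h₁, h₂⟩, ?_, ?_⟩
  · calc a ≫ c ≫ q ▷ H = ((c ≫ q ▷ H) ≫ j ▷ H ≫ a) ▷ H ≫ a ≫ c ≫ q ▷ H := by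
          rw [h₁, id_whiskerRight, Category.id_comp]
      _ = (c ≫ q ▷ H) ▷ H ≫ (freeAct H J ≫ j ▷ H ≫ a) ≫ c ≫ q ▷ H := by
          rw [hψ, comp_whiskerRight _ (j ▷ H ≫ a)]; simp only [Category.assoc]
      _ = _ := by
          have := h₂
          simp only [Category.assoc] at this ⊢
          rw [this, Category.comp_id]
  · calc c ≫ (c ≫ q ▷ H) ▷ H = (c ≫ c ▷ H ≫ (α_ X H H).hom) ⊗≫ q ▷ H ▷ H := by monoidal
      _ = c ≫ (X ◁ Δ[H] ≫ q ▷ (H ⊗ H)) ⊗≫ 𝟙 _ := by rw [← hX.coact_comul]; monoidal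
      _ = _ := by rw [whisker_exchange, freeCoact]; monoidal

end IsHopfModule

end Coinvariants

/-! ### Left integrals as coinvariants of the maximal rational submodule. -/

section Integrals

section Categorical

variable {C : Type u} [Category.{v} C] [MonoidalCategory C] {H N : C} [MonObj H]

/-- Evaluation at the unit, `n ↦ ⟨n, 1⟩`. -/
def evalOne (p : N ⊗ H ⟶ 𝟙_ C) : N ⟶ 𝟙_ C := (ρ_ N).inv ≫ N ◁ η[H] ≫ p

theorem isLeftModule_of_mono [MonObj N] {U : C} (f : U ⟶ N) [Mono f] (b : N ⊗ U ⟶ U)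
    (hb : b ≫ f = N ◁ f ≫ μ[N]) : IsLeftModule N U b where
  one_act := by
    rw [← cancel_mono f, Category.assoc, hb, ← whisker_exchange_assoc, MonObj.one_mul,
      leftUnitor_naturality]
  mul_act := by
    rw [← cancel_mono f]
    simp only [Category.assoc]
    rw [hb, ← whisker_exchange_assoc, MonObj.mul_assoc, ← whiskerLeft_comp_assoc, hb]
    simp

variable [BraidedCategory C]

/-- The trivial coaction u ↦ u ⊗ 1 corresponds to the action g · u = g(1) u; this makes any object
of integrals rational. -/
theorem mcom_evalOne (p : N ⊗ H ⟶ 𝟙_ C) (U : C) :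
    MCOM p (copointT (evalOne p) U) ((ρ_ U).inv ≫ U ◁ η[H]) := by
  unfold MCOM
  calc _ = ((β_ N U).hom ≫ U ◁ evalOne p) ⊗≫ 𝟙 _ := ?_
    _ = _ := by
      rw [← braiding_naturality_left, braiding_tensorUnit_left, copointT]; monoidal
  calc _ = 𝟙 _ ⊗≫ ((N ⊗ U) ◁ η[H] ≫ (β_ N U).hom ▷ H) ⊗≫ U ◁ p ⊗≫ 𝟙 _ := by monoidal
    _ = _ := by rw [whisker_exchange, evalOne]; monoidal

end Categorical

section HopfCase

variable {C : Type u} [Category.{v} C] [MonoidalCategory C] [BraidedCategory C]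
  {H N : C} [HopfObj H] {p : N ⊗ H ⟶ 𝟙_ C}

theorem IsFaithfulQuasiDual.eq_of_mcom [MonObj N] (hp : IsFaithfulQuasiDual H N p) {U V : C}
    {g g' : U ⟶ V ⊗ H}
    (h : N ◁ g ≫ (α_ N V H).inv ≫ (β_ N V).hom ▷ H ≫ (α_ V N H).hom ≫ V ◁ p ≫ (ρ_ V).hom =
      N ◁ g' ≫ (α_ N V H).inv ≫ (β_ N V).hom ▷ H ≫ (α_ V N H).hom ≫ V ◁ p ≫ (ρ_ V).hom) :
    g = g' := by
  apply hp.hom_ext_right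
  have key (g : U ⟶ V ⊗ H) :
      N ◁ splitT g (𝟙_ C) ≫ swapT N V (H ⊗ 𝟙_ C) ≫ V ◁ pairT p (𝟙_ C) =
      𝟙 _ ⊗≫ (N ◁ g ≫ (α_ N V H).inv ≫ (β_ N V).hom ▷ H ≫ (α_ V N H).hom ≫ V ◁ p ≫
        (ρ_ V).hom) ⊗≫ 𝟙 _ := by
    simp only [splitT, swapT, pairT]; monoidal
  rw [key, key, h]

theorem coinvariant_comp_act {R J : C} {a : N ⊗ R ⟶ R} {r : R ⟶ R ⊗ H} (hr : MCOM p a r)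
    {j : J ⟶ R} (hj : j ≫ r = j ≫ (ρ_ R).inv ≫ R ◁ η[H]) :
    N ◁ j ≫ a = copointT (evalOne p) J ≫ j := by
  rw [copointT_nat, ← show _ = a from hr, ← whiskerLeft_comp_assoc, hj, whiskerLeft_comp_assoc,
    show _ = copointT (evalOne p) R from mcom_evalOne p R]

/-- Given coaction and trivial coaction have the same pairings with N along `t`, hence agree there
by faithfulness. -/
theorem coinvariant_of_act [MonObj N] (hp : IsFaithfulQuasiDual H N p) {R U : C} {a : N ⊗ R ⟶ R}
    {r : R ⟶ R ⊗ H} (hr : MCOM p a r) {t : U ⟶ R} (ht : N ◁ t ≫ a = copointT (evalOne p) U ≫ t) :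
    t ≫ r = t ≫ (ρ_ R).inv ≫ R ◁ η[H] := by
  apply hp.eq_of_mcom
  rw [whiskerLeft_comp_assoc, whiskerLeft_comp_assoc, show _ = a from hr,
    show _ = copointT (evalOne p) R from mcom_evalOne p R, ht, copointT_nat]

end HopfCase

section Elements

variable {k : Type w} [Field k] {C : Type u} [Category.{v} C] [MonoidalCategory C]
  (F : C ⥤ ModuleCat.{w} k) [F.Monoidal] {H N : C} [MonObj H]

theorem toDual_oneElt (p : N ⊗ H ⟶ 𝟙_ C) (g : F.obj N) :
    toDual F p g (oneElt F H) = (F.map (evalOne p) ≫ Functor.OplaxMonoidal.η F).hom g := by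
  have h : F.obj N ◁ (Functor.LaxMonoidal.ε F ≫ F.map η[H]) ≫ Functor.LaxMonoidal.μ F N H ≫
      F.map p = (ρ_ (F.obj N)).hom ≫ F.map (evalOne p) := by
    rw [Functor.LaxMonoidal.right_unitality, evalOne]
    simp only [whiskerLeft_comp, Category.assoc, ← Functor.map_comp, Iso.hom_inv_id_assoc]
    rw [Functor.LaxMonoidal.μ_natural_right_assoc, ← Functor.map_comp]
  have h' := congrArg (fun q ↦ (Functor.OplaxMonoidal.η F).hom (q.hom (g ⊗ₜ[k] (1 : k)))) h
  refine Eq.trans ?_ (h'.trans ?_)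
  · rfl
  · change (Functor.OplaxMonoidal.η F).hom ((F.map (evalOne p)).hom ((1 : k) • g)) = _
    rw [one_smul]; rfl

theorem map_copointT (e : N ⟶ 𝟙_ C) {U : C} (g : F.obj N) (x : F.obj U) :
    (Functor.LaxMonoidal.μ F N U ≫ F.map (copointT e U)).hom (g ⊗ₜ[k] x) =
      (show k from (F.map e ≫ Functor.OplaxMonoidal.η F).hom g) • x := by
  have h : Functor.LaxMonoidal.μ F N U ≫ F.map (copointT e U) =
      (F.map e ≫ Functor.OplaxMonoidal.η F) ▷ F.obj U ≫ (λ_ (F.obj U)).hom := by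
    rw [Functor.LaxMonoidal.left_unitality, copointT, Functor.map_comp,
      ← Functor.LaxMonoidal.μ_natural_left_assoc, comp_whiskerRight_assoc,
      ← comp_whiskerRight_assoc (Functor.OplaxMonoidal.η F), Functor.Monoidal.η_ε,
      id_whiskerRight, Category.id_comp]
  rw [h]
  rfl

variable [MonObj N]

theorem map_whiskerLeft_mul {U : C} (f : U ⟶ N) (g : F.obj N) (x : F.obj U) :
    (Functor.LaxMonoidal.μ F N U ≫ F.map (N ◁ f ≫ μ[N])).hom (g ⊗ₜ[k] x) =
      mulElt F g ((F.map f).hom x) := by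
  rw [Functor.map_comp, ← Functor.LaxMonoidal.μ_natural_right_assoc]
  rfl

/-- Bridge from elements to morphisms: `F` is faithful, its tensor comparison is invertible, and
linear maps on a tensor product are determined by pure tensors. -/
theorem range_subset_leftIntegrals_iff [F.Faithful] (p : N ⊗ H ⟶ 𝟙_ C) {U : C} (f : U ⟶ N) :
    Set.range (F.map f).hom ⊆ leftIntegrals F p ↔
      N ◁ f ≫ μ[N] = copointT (evalOne p) U ≫ f := by
  have key (g : F.obj N) (x : F.obj U) :
      (Functor.LaxMonoidal.μ F N U ≫ F.map (copointT (evalOne p) U ≫ f)).hom (g ⊗ₜ[k] x) =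
        toDual F p g (oneElt F H) • (F.map f).hom x := by
    rw [toDual_oneElt, Functor.map_comp, ← Category.assoc, ModuleCat.hom_comp,
      LinearMap.comp_apply, map_copointT, map_smul]
  constructor
  · intro h
    apply F.map_injective
    rw [← cancel_epi (Functor.LaxMonoidal.μ F N U)]
    refine ModuleCat.hom_ext (TensorProduct.ext' fun g x ↦ ?_)
    rw [map_whiskerLeft_mul, key]
    exact h ⟨x, rfl⟩ g
  · rintro h _ ⟨x, rfl⟩ g
    rw [← map_whiskerLeft_mul, h, key]

end Elements

section IntegralObject

variable {k : Type w} [Field k] {C : Type u} [Category.{v} C] [MonoidalCategory C]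
  [BraidedCategory C] (F : C ⥤ ModuleCat.{w} k) [F.Monoidal] [F.Faithful]
  {H N R : C} [HopfObj H] [MonObj N] {p : N ⊗ H ⟶ 𝟙_ C}
  {i : R ⟶ N} {a : N ⊗ R ⟶ R} {r : R ⟶ R ⊗ H}

/-- The coinvariants of the maximal rational submodule are the left integrals. -/
theorem IsMaximalRationalSubmodule.isIntegralObject (hp : IsFaithfulQuasiDual H N p)
    (hR : IsMaximalRationalSubmodule p i a r) {J : C} (j : J ⟶ R) [Mono j]
    (hj : j ≫ r = j ≫ (ρ_ R).inv ≫ R ◁ η[H])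
    (huniv : ∀ {U : C} (t : U ⟶ R), t ≫ r = t ≫ (ρ_ R).inv ≫ R ◁ η[H] → ∃ s : U ⟶ J, s ≫ j = t) :
    IsIntegralObject F p (j ≫ i) := by
  have := hR.mono
  refine ⟨mono_comp _ _, ?_, fun {U} f hf hrange ↦ ?_⟩
  · rw [range_subset_leftIntegrals_iff, whiskerLeft_comp, Category.assoc, ← hR.act_comp,
      reassoc_of% (coinvariant_comp_act hR.mcom hj)]
  · rw [range_subset_leftIntegrals_iff] at hrange
    -- The witnesses are the action through g ↦ g(1) and the trivial coaction.
    obtain ⟨t, rfl⟩ := hR.greatest f _ _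
      ⟨hf, isLeftModule_of_mono f _ hrange.symm, hrange.symm, mcom_evalOne p U⟩
    obtain ⟨s, rfl⟩ := huniv t (coinvariant_of_act hp hR.mcom (by
      rw [← cancel_mono i, Category.assoc, Category.assoc, hR.act_comp,
        ← whiskerLeft_comp_assoc, hrange]))
    exact ⟨s, (Category.assoc _ _ _).symm⟩

end IntegralObject

end Integrals

end BraidedIntegral

theorem corollary2p2 {k : Type w} [Field k] {C : Type u} [Category.{v} C]
    [MonoidalCategory C] [BraidedCategory C] [Limits.HasEqualizers C]
    (F : C ⥤ ModuleCat.{w} k) [F.Monoidal] [F.Faithful]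
    (H : C) [HopfObj H] (hsymm : (β_ H H).hom = (β_ H H).inv)
    -- the faithful quasi-dual `H^d ⊆ H^*`, with `⟨ , ⟩` the evaluation
    (Hd : C) [MonObj Hd] (p : Hd ⊗ H ⟶ 𝟙_ C)
    (hp : BraidedIntegral.IsFaithfulQuasiDual H Hd p)
    (hsub : Function.Injective (BraidedIntegral.toDual F p))
    -- the maximal rational submodule `R = H^{d rat}`
    (R : C) (i : R ⟶ Hd) (a : Hd ⊗ R ⟶ R) (r : R ⟶ R ⊗ H)
    (hR : BraidedIntegral.IsMaximalRationalSubmodule p i a r)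
    -- `⇀` is a morphism of `C` and restricts to a morphism `H ⊗ R ⟶ R`
    (l : H ⊗ Hd ⟶ Hd) (hl : BraidedIntegral.IsHit p l)
    (lR : H ⊗ R ⟶ R) (hlR : lR ≫ i = H ◁ i ≫ l) :
    BraidedIntegral.IsHopfModule H R (BraidedIntegral.antipodeAction lR) r ∧
    ∃ (J : C) (e : J ⟶ Hd),
      BraidedIntegral.IsIntegralObject F p e ∧
      -- `J` is the full set of left integrals as soon as that set underlies an object of `C`
      ((∃ (T : C) (t : T ⟶ Hd), Function.Injective (F.map t).hom ∧
          Set.range (F.map t).hom = BraidedIntegral.leftIntegrals F p) →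
        Set.range (F.map e).hom = BraidedIntegral.leftIntegrals F p) ∧
      BraidedIntegral.IsHopfModule H (J ⊗ H)
        (BraidedIntegral.freeAct H J) (BraidedIntegral.freeCoact H J) ∧
      ∃ φ : R ≅ J ⊗ H,
        BraidedIntegral.antipodeAction lR ≫ φ.hom =
          φ.hom ▷ H ≫ BraidedIntegral.freeAct H J ∧
        r ≫ φ.hom ▷ H = φ.hom ≫ BraidedIntegral.freeCoact H J := by
  have hX := hR.isHopfModule hsymm hp hl hlR
  -- The coinvariants of R, the equalizer of its coaction with x ↦ x ⊗ 1.
  set j := Limits.equalizer.ι r ((ρ_ R).inv ≫ R ◁ η[H])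
  have hcond : j ≫ r = j ≫ (ρ_ R).inv ≫ R ◁ η[H] := Limits.equalizer.condition _ _
  have huniv {U : C} (t : U ⟶ R) (ht : t ≫ r = t ≫ (ρ_ R).inv ≫ R ◁ η[H]) :
      ∃ s, s ≫ j = t := ⟨Limits.equalizer.lift t ht, Limits.equalizer.lift_ι t ht⟩
  have hJ := hR.isIntegralObject F hp j hcond huniv
  refine ⟨hX, _, j ≫ i, hJ, ?_, BraidedIntegral.isHopfModule_free H _,
    hX.exists_iso_free j hcond (huniv _ hX.coinvariantProj_coact)⟩
  rintro ⟨T, t, ht, hrange⟩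
  refine hJ.range_subset.antisymm ?_
  -- A faithful functor reflects monomorphisms, so `t` is a subobject to which maximality of the
  -- integral object applies.
  have hmono : Mono t := F.mono_of_mono_map ((ModuleCat.mono_iff_injective _).2 ht)
  obtain ⟨s, rfl⟩ := hJ.greatest t hmono hrange.subset
  rw [← hrange, F.map_comp, ModuleCat.hom_comp, LinearMap.coe_comp]
  exact Set.range_comp_subset_range _ _
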